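/- Notation. For finite signed Borel measures on $\mathbb R^d$, $*$ denotes convolution, $I$ is the unit mass at $\vec 0$, $M^{*0}=I$, $M^{*j}$ is the $j$-fold convolution power, and $\exp\{M\}=\sum_{j\ge 0}M^{*j}/j!$. The total variation distance is $d(M,V)=\sup_B|M\{B\}-V\{B\}|$, the supremum being over all Borel sets $B\subset\mathbb R^d$. For a distribution $F$ and real $a$ put $$D^{*a}=\exp\Big\{a(F-I)-\frac{a(F-I)^{*2}}{2}\Big\}.$$ Statement. There is an absolute constant $C>0$ such that the following holds for all $d,N,n\in\mathbb N$ with $n\ge 1$ and $N\ge d$. Let $F$ be a symmetric probability distribution on $\mathbb R^d$ with $\operatorname{supp}F\subset\mathbb Z^d$ and $$\operatorname{supp}F=\{\vec 0,\pm\vec x_1,\dots,\pm\vec x_N\},\qquad q:=F\{\vec 0\}\in(0,1).$$ Then $$d\big(F^{*n},\exp\{n(F-I)\}\big)\le\frac{2.17N^2}{n}\Big(1+\frac{CN}{q^5\sqrt n}\Big),$$ $$d\big(F^{*n},F^{*(n+1)}\big)\le\frac{CN^2q^{-7/2}}{n},\qquad d\big(F^{*n},D^{*n}\big)\le\frac{CN^3q^{-7/2}}{n^2},$$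 $$d\Big(F^{*n},\ \exp\{n(F-I)\}*\Big(I-\frac{n(F-I)^{*2}}{2}\Big)\Big)\le\frac{CN^4q^{-13/2}}{n^2}.$$ -/

import Mathlib

open MeasureTheory

noncomputable section

namespace CompoundPoisson

variable {E : Type*} [MeasurableSpace E]

/-- A finite signed measure has finite total variation. This makes every product of signed measures
below a genuine one. -/
instance isFiniteMeasure_variation (M : SignedMeasure E) :
    IsFiniteMeasure (VectorMeasure.variation M) := by
  rw [← SignedMeasure.totalVariation_eq_variation]
  infer_instance

/-- The total variation distance `sup_B |M(B) - V(B)|`, the supremum being over all measurable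
sets `B`. -/
def tvDist (M V : SignedMeasure E) : ℝ :=
  ⨆ B : {B : Set E // MeasurableSet B}, |M (B : Set E) - V (B : Set E)|

/-- The supremum in `tvDist` is over a bounded set of reals. -/
theorem bddAbove_tvDist (M V : SignedMeasure E) :
    BddAbove (Set.range fun B : {B : Set E // MeasurableSet B} =>
      |M (B : Set E) - V (B : Set E)|) := by
  refine ⟨(VectorMeasure.bound (M - V) : ℝ), ?_⟩
  rintro _ ⟨B, rfl⟩
  have h := VectorMeasure.norm_apply_le_bound (μ := M - V) (s := (B : Set E))
  simpa [Real.norm_eq_abs] using h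

variable [AddMonoid E]

/-- Convolution of finite signed measures: the image of the product measure under addition, that is,
`(M * V)(A) = ∫ M(A - x) V(dx)`. -/
def conv (M V : SignedMeasure E) : SignedMeasure E :=
  (VectorMeasure.prod M V (ContinuousLinearMap.mul ℝ ℝ)).map fun p : E × E => p.1 + p.2

/-- The unit mass at the origin. -/
def unitMass : SignedMeasure E := VectorMeasure.dirac (0 : E) (1 : ℝ)

/-- Convolution powers, with `M^{*0}` the unit mass at the origin. -/
def convPow (M : SignedMeasure E) : ℕ → SignedMeasure E
  | 0 => unitMass
  | j + 1 => conv (convPow M j) M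

/-- Powers of the total variation norm bound the total variation of convolution powers. -/
theorem variation_convPow_le [MeasurableAdd₂ E] (M : SignedMeasure E) (j : ℕ) :
    (VectorMeasure.variation (convPow M j)).real Set.univ ≤
      (VectorMeasure.variation M).real Set.univ ^ j := by
  induction j with
  | zero =>
    rw [convPow, unitMass, VectorMeasure.variation_dirac]
    simp [Measure.real]
  | succ j ih =>
    have hB : ‖ContinuousLinearMap.mul ℝ ℝ‖ₑ = 1 := by
      rw [← ofReal_norm, ContinuousLinearMap.opNorm_mul, ENNReal.ofReal_one]
    have h1 : VectorMeasure.variation (convPow M (j + 1)) Set.univ ≤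
        VectorMeasure.variation (convPow M j) Set.univ *
          VectorMeasure.variation M Set.univ := by
      calc VectorMeasure.variation (convPow M (j + 1)) Set.univ
          ≤ ((VectorMeasure.prod (convPow M j) M (ContinuousLinearMap.mul ℝ ℝ)).variation.map
              fun p : E × E => p.1 + p.2) Set.univ :=
            VectorMeasure.variation_map_le Set.univ
        _ = (VectorMeasure.prod (convPow M j) M
              (ContinuousLinearMap.mul ℝ ℝ)).variation Set.univ := by
            rw [Measure.map_apply measurable_add MeasurableSet.univ, Set.preimage_univ]
        _ ≤ (‖ContinuousLinearMap.mul ℝ ℝ‖ₑ •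
              (VectorMeasure.variation (convPow M j)).prod (VectorMeasure.variation M))
                Set.univ :=
            VectorMeasure.variation_prod_le Set.univ
        _ = _ := by
            rw [hB, one_smul, ← Set.univ_prod_univ, Measure.prod_prod]
    have h2 := ENNReal.toReal_mono (by finiteness) h1
    rw [ENNReal.toReal_mul] at h2
    rw [pow_succ]
    exact h2.trans (mul_le_mul_of_nonneg_right ih ENNReal.toReal_nonneg)

/-- The variations of the convolution powers, summed over disjoint measurable sets. -/
theorem tsum_variation_convPow_le [MeasurableAdd₂ E] (M : SignedMeasure E) {f : ℕ → Set E}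
    (hf : ∀ i, MeasurableSet (f i)) (hd : Pairwise (Function.onFun Disjoint f)) (j : ℕ) :
    Summable (fun i => (VectorMeasure.variation (convPow M j)).real (f i)) ∧
      ∑' i, (VectorMeasure.variation (convPow M j)).real (f i) ≤
        (VectorMeasure.variation M).real Set.univ ^ j := by
  refine ⟨summable_measure_toReal hf hd, ?_⟩
  calc ∑' i, (VectorMeasure.variation (convPow M j)).real (f i)
      = (VectorMeasure.variation (convPow M j)).real (⋃ i, f i) := by
        rw [Measure.real, measure_iUnion hd hf, ENNReal.tsum_toReal_eq fun _ => by finiteness]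
        rfl
    _ ≤ (VectorMeasure.variation (convPow M j)).real Set.univ :=
        measureReal_mono (Set.subset_univ _)
    _ ≤ _ := variation_convPow_le M j

/-- A criterion for the absolute convergence of an exponential double series. -/
theorem summable_expSeries (a b : ℕ → ℕ → ℝ) (v : ℝ) (hb : ∀ j i, 0 ≤ b j i)
    (hab : ∀ j i, |a j i| ≤ b j i) (h : ∀ j, Summable (b j) ∧ ∑' i, b j i ≤ v ^ j) :
    Summable fun p : ℕ × ℕ => a p.1 p.2 / (p.1.factorial : ℝ) := by
  have hn : ∀ p : ℕ × ℕ, 0 ≤ b p.1 p.2 / (p.1.factorial : ℝ) := fun p =>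
    div_nonneg (hb _ _) (Nat.cast_nonneg _)
  have hs : Summable fun p : ℕ × ℕ => b p.1 p.2 / (p.1.factorial : ℝ) := by
    have hn' : (0 : ℕ × ℕ → ℝ) ≤ fun p => b p.1 p.2 / (p.1.factorial : ℝ) := fun p => hn p
    rw [summable_prod_of_nonneg hn']
    refine ⟨fun j => Summable.div_const (f := b j) (h j).1 (j.factorial : ℝ), ?_⟩
    refine Summable.of_nonneg_of_le (fun j => tsum_nonneg fun i => hn (j, i)) (fun j => ?_)
      (Real.summable_pow_div_factorial v)
    simp only [tsum_div_const]
    exact div_le_div_of_nonneg_right (h j).2 (Nat.cast_nonneg _)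
  refine hs.of_norm_bounded fun p => ?_
  rw [norm_div, Real.norm_natCast, Real.norm_eq_abs]
  exact div_le_div_of_nonneg_right (hab _ _) (Nat.cast_nonneg _)

/-- The double series behind the countable additivity of the exponential measure converges
absolutely. -/
theorem summable_expMeasure [MeasurableAdd₂ E] (M : SignedMeasure E) {f : ℕ → Set E}
    (hf : ∀ i, MeasurableSet (f i)) (hd : Pairwise (Function.onFun Disjoint f)) :
    Summable fun p : ℕ × ℕ => (convPow M p.1) (f p.2) / (p.1.factorial : ℝ) :=
  summable_expSeries (fun j i => (convPow M j) (f i))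
    (fun j i => (VectorMeasure.variation (convPow M j)).real (f i))
    ((VectorMeasure.variation M).real Set.univ) (fun _ _ => measureReal_nonneg)
    (fun j i => VectorMeasure.norm_measure_le_variation (μ := convPow M j) (E := f i))
    (tsum_variation_convPow_le M hf hd)

/-- Countable additivity of the exponential series. -/
theorem hasSum_expMeasure [MeasurableAdd₂ E] (M : SignedMeasure E) {f : ℕ → Set E}
    (hf : ∀ i, MeasurableSet (f i)) (hd : Pairwise (Function.onFun Disjoint f)) :
    HasSum (fun i => ∑' j : ℕ, (convPow M j) (f i) / (j.factorial : ℝ))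
      (∑' j : ℕ, (convPow M j) (⋃ i, f i) / (j.factorial : ℝ)) := by
  have hs := summable_expMeasure M hf hd
  have h1 : ∀ j, (convPow M j) (⋃ i, f i) / (j.factorial : ℝ) =
      ∑' i, (convPow M j) (f i) / (j.factorial : ℝ) := fun j => by
    rw [VectorMeasure.of_disjoint_iUnion hf hd, tsum_div_const]
  rw [tsum_congr h1, ← hs.tsum_comm]
  exact hs.prod_symm.prod.hasSum

/-- The exponential measure `exp{M} = ∑_{j ≥ 0} M^{*j} / j!`. -/
def expMeasure [MeasurableAdd₂ E] (M : SignedMeasure E) : SignedMeasure E where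
  measureOf' A := ∑' j : ℕ, (convPow M j) A / (j.factorial : ℝ)
  empty' := by simp
  not_measurable' A hA := by simp [VectorMeasure.not_measurable _ hA]
  m_iUnion' _ hf hd := hasSum_expMeasure M hf hd

/-- The accompanying compound Poisson law of the `n`-fold convolution: `exp{n(F - I)}`. -/
def accompanying [MeasurableAdd₂ E] (F : SignedMeasure E) (n : ℝ) : SignedMeasure E :=
  expMeasure (n • (F - unitMass))

/-- Hipp's second-order signed compound Poisson measure
`D^{*a} = exp{a(F - I) - a(F - I)^{*2} / 2}`. -/
def hipp [MeasurableAdd₂ E] (F : SignedMeasure E) (a : ℝ) : SignedMeasure E :=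
  expMeasure (a • (F - unitMass) - (a / 2) • convPow (F - unitMass) 2)

/-- The first-order asymptotic expansion `exp{n(F - I)} * (I - n(F - I)^{*2} / 2)`. -/
def cpExpansion [MeasurableAdd₂ E] (F : SignedMeasure E) (n : ℝ) : SignedMeasure E :=
  conv (accompanying F n) (unitMass - (n / 2) • convPow (F - unitMass) 2)

end CompoundPoisson

end

set_option linter.unusedSectionVars false

namespace CompoundPoisson

/-! Write F = I + z. The law F, its powers and every comparison measure are functions of z in the
commutative Banach algebra of summable discrete signed measures, and total variation distance is at
most the norm of a difference there (`Represents.tvDist_le`). The generator z is a sum of N terms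
p_i (S_i - 1), with S_i the average of the unit masses u, v at x_i and -x_i.

Every rate comes from smoothing. Since uv = 1, S_i - 1 = -(1 - u)(1 - v)/2 is a product of two first
differences, each damped like b^(-1/2) by exp(b(u - 1)) or exp(b(v - 1)), because the coefficients
that appear measure the deviation of a Poisson variable from its mean. The weight p_i cancels
against the time a p_i spent in direction i, so the norm of z exp(az) is at most N/a
(`norm_gen_mul_exp_le`). For powers, F^2 contains a lazy walk of weight 2 q p_i in each direction,
and the norm of z F^n is at most 2N/(q(n+1)) (`norm_gen_mul_pow_le`).

The element exp(z - z^2/2) agrees with 1 + z up to a multiple of z^3, so the telescoped difference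
of nth powers has n terms of order n^(-3). This requires a bound, uniform in a, on the signed
exponentials exp(az - t a z^2/2) with t in [0, 1]. With z = (1 - q)(G - 1) and G of norm at most
one, they are exponentials of quadratic polynomials in G. The sum of absolute coefficients is
controlled by L^2 norms on the unit circle (`sq_norm_aeval_le`), where q > 0 forces Gaussian-type
decay away from 1 (`sq_norm_exp_quadratic_le`).

Taylor expansion in n z^2/2 then gives the expansion with correction -(n/2) z^2 exp(nz). That
correction has norm at most 2N^2/n, which fits under the constant 2.17; everything else is of higher
order. -/

theorem hasSum_of_eq {ι M : Type*} [AddCommMonoid M] [TopologicalSpace M] {f g : ι → M} {a b : M}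
    (h : HasSum f a) (hf : ∀ i, g i = f i) (hb : b = a) : HasSum g b := by
  rw [hb, funext hf]
  exact h

/-! ### Exponentials in a Banach algebra and Poisson smoothing -/

section BanachExp

open NormedSpace

variable {A : Type*} [NormedCommRing A] [NormedAlgebra ℝ A] [CompleteSpace A]

theorem banach_exp_add (x y : A) : exp (x + y) = exp x * exp y := by
  let := NormedAlgebra.restrictScalars ℚ ℝ A
  exact exp_add

theorem banach_exp_nsmul (n : ℕ) (x : A) : exp (n • x) = exp x ^ n := by
  let := NormedAlgebra.restrictScalars ℚ ℝ A
  exact exp_nsmul n x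

theorem banach_exp_smul_one (c : ℝ) : exp (c • (1 : A)) = Real.exp c • (1 : A) := by
  have h := algebraMap_exp_comm (𝕂 := ℝ) (𝔸 := A) c
  rw [Algebra.algebraMap_eq_smul_one, Algebra.algebraMap_eq_smul_one, ← Real.exp_eq_exp_ℝ] at h
  exact h.symm

theorem hasSum_banach_exp_smul (b : ℝ) (u : A) :
    HasSum (fun k : ℕ => (b ^ k / k.factorial) • u ^ k) (exp (b • u)) := by
  have h := exp_series_hasSum_exp' (𝕂 := ℝ) (b • u)
  refine h.congr_fun fun k => ?_
  rw [smul_pow, smul_smul]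
  congr 1
  ring

theorem hasSum_real_exp (b : ℝ) :
    HasSum (fun k : ℕ => b ^ k / (k.factorial : ℝ)) (Real.exp b) := by
  rw [Real.exp_eq_exp_ℝ]
  exact expSeries_div_hasSum_exp b

/-- Multiplying the exponential series by its variable shifts the coefficients. -/
theorem hasSum_mul_banach_exp_smul {b : ℝ} (u : A) :
    HasSum (fun k : ℕ => (k * b ^ k / k.factorial) • u ^ k) (b • (u * exp (b • u))) := by
  rw [← hasSum_nat_add_iff' 1]
  simp only [Finset.range_one, Finset.sum_singleton, Nat.cast_zero, zero_mul, zero_div, zero_smul,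
    sub_zero]
  refine (((hasSum_banach_exp_smul b u).mul_left u).const_smul b).congr_fun fun k => ?_
  rw [mul_smul_comm, smul_smul, ← pow_succ', Nat.factorial_succ]
  congr 1
  push_cast
  have h1 : (k.factorial : ℝ) ≠ 0 := by positivity
  have h2 : (k : ℝ) + 1 ≠ 0 := by positivity
  field_simp
  ring

variable [NormOneClass A]

theorem norm_banach_exp_le (x : A) : ‖exp x‖ ≤ Real.exp ‖x‖ := by
  have h := exp_series_hasSum_exp' (𝕂 := ℝ) x
  rw [← h.tsum_eq]
  refine tsum_of_norm_bounded (hasSum_real_exp ‖x‖) fun k => ?_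
  rw [norm_smul, norm_inv, Real.norm_natCast, div_eq_inv_mul]
  gcongr
  exact norm_pow_le x k

/-- The scalar part contributes exp(-a), which exactly offsets the bound exp(a) for the exponential
of aG. -/
theorem norm_exp_smul_sub_one_le {G : A} (hG : ‖G‖ ≤ 1) {a : ℝ} (ha : 0 ≤ a) :
    ‖exp (a • (G - 1))‖ ≤ 1 := by
  have h : a • (G - 1) = (-a) • (1 : A) + a • G := by rw [smul_sub, neg_smul]; ring
  rw [h, banach_exp_add, banach_exp_smul_one, smul_one_mul, norm_smul, Real.norm_eq_abs,
    Real.abs_exp]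
  calc Real.exp (-a) * ‖exp (a • G)‖ ≤ Real.exp (-a) * Real.exp a := by
        gcongr
        refine (norm_banach_exp_le _).trans (Real.exp_le_exp.2 ?_)
        rw [norm_smul, Real.norm_of_nonneg ha]
        exact mul_le_of_le_one_right ha hG
    _ = 1 := by rw [← Real.exp_add]; simp

/-- The variance of a Poisson variable of mean b, before division by exp(b). It bounds the first
absolute deviation that arises in smoothing. -/
theorem hasSum_poisson_variance {b : ℝ} :
    HasSum (fun k : ℕ => b ^ k / k.factorial * (k - b) ^ 2) (b * Real.exp b) := by
  have h0 := hasSum_real_exp b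
  have h1 := hasSum_mul_banach_exp_smul (A := ℝ) (b := b) 1
  have h2 : HasSum (fun k : ℕ => (k ^ 2 * b ^ k / k.factorial : ℝ))
      ((b ^ 2 + b) * Real.exp b) := by
    rw [← hasSum_nat_add_iff' 1]
    simp only [Finset.range_one, Finset.sum_singleton, Nat.cast_zero]
    simp only [one_pow, smul_eq_mul, mul_one, one_mul, ← Real.exp_eq_exp_ℝ] at h1
    refine hasSum_of_eq ((h1.add h0).mul_left b) (fun k => ?_) ?_
    · rw [Nat.factorial_succ]
      push_cast
      have h1 : (k.factorial : ℝ) ≠ 0 := by positivity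
      have h2 : (k : ℝ) + 1 ≠ 0 := by positivity
      field_simp
      ring
    · simp
      ring
  simp only [one_pow, smul_eq_mul, mul_one, one_mul, ← Real.exp_eq_exp_ℝ] at h1
  refine hasSum_of_eq ((h2.sub (h1.mul_left (2 * b))).add (h0.mul_left (b ^ 2)))
    (fun k => ?_) ?_
  · ring
  · ring

/-- The Poisson semigroup smooths the difference operator at rate `b ^ (-1/2)`. -/
theorem norm_one_sub_mul_exp_le {u : A} (hu : ‖u‖ ≤ 1) {b : ℝ} (hb : 0 < b) :
    ‖(1 - u) * exp (b • (u - 1))‖ ≤ 1 / √b := by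
  have hs : HasSum (fun k : ℕ => (b ^ k / k.factorial * ((b - k) / b)) • u ^ k)
      ((1 - u) * exp (b • u)) := by
    refine hasSum_of_eq ((hasSum_banach_exp_smul b u).sub
      ((hasSum_mul_banach_exp_smul (b := b) u).const_smul (1 / b))) (fun k => ?_) ?_
    · rw [smul_smul, ← sub_smul]
      congr 1
      field_simp
    · rw [smul_smul, one_div_mul_cancel hb.ne', one_smul, sub_mul, one_mul]
  have hsb : 0 < √b := Real.sqrt_pos.2 hb
  have hsq : √b ^ 2 = b := Real.sq_sqrt hb.le
  have hbd : HasSum (fun k : ℕ => b ^ k / k.factorial * (k - b) ^ 2 * (1 / (2 * b * √b)) +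
      b ^ k / k.factorial * (1 / (2 * √b))) (Real.exp b / √b) := by
    refine hasSum_of_eq ((hasSum_poisson_variance.mul_right (1 / (2 * b * √b))).add
      ((hasSum_real_exp b).mul_right (1 / (2 * √b)))) (fun k => rfl) ?_
    field_simp
    norm_num
  have h1 : ‖(1 - u) * exp (b • u)‖ ≤ Real.exp b / √b := by
    rw [← hs.tsum_eq]
    refine tsum_of_norm_bounded hbd fun k => ?_
    have hp : 0 ≤ b ^ k / (k.factorial : ℝ) := by positivity
    -- The inequality |y| ≤ (y^2 + s^2)/(2s) with s = √b, so that after summation the variance and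
    -- the total mass contribute equally.
    have hk : |(b - k) / b| ≤ (k - b) ^ 2 * (1 / (2 * b * √b)) + 1 / (2 * √b) := by
      rw [abs_div, abs_of_pos hb, abs_sub_comm, div_le_iff₀ hb]
      have e : ((k - b) ^ 2 * (1 / (2 * b * √b)) + 1 / (2 * √b)) * b =
          (|(k : ℝ) - b| ^ 2 + √b ^ 2) / (2 * √b) := by
        rw [hsq, sq_abs]
        field_simp
      rw [e, le_div_iff₀ (by positivity)]
      nlinarith [sq_nonneg (|(k : ℝ) - b| - √b)]
    calc ‖(b ^ k / k.factorial * ((b - k) / b)) • u ^ k‖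
        ≤ b ^ k / k.factorial * |(b - k) / b| * 1 := by
          rw [norm_smul, norm_mul, Real.norm_of_nonneg hp, Real.norm_eq_abs]
          gcongr
          exact (norm_pow_le u k).trans (pow_le_one₀ (norm_nonneg _) hu)
      _ ≤ b ^ k / k.factorial * ((k - b) ^ 2 * (1 / (2 * b * √b)) + 1 / (2 * √b)) := by
          rw [mul_one]
          gcongr
      _ = _ := by ring
  have h : b • (u - 1) = (-b) • (1 : A) + b • u := by rw [smul_sub, neg_smul]; ring
  rw [h, banach_exp_add, banach_exp_smul_one, smul_one_mul, mul_smul_comm, norm_smul,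
    Real.norm_eq_abs, Real.abs_exp]
  calc Real.exp (-b) * ‖(1 - u) * exp (b • u)‖ ≤ Real.exp (-b) * (Real.exp b / √b) := by gcongr
    _ = 1 / √b := by rw [← mul_div_assoc, ← Real.exp_add]; simp

end BanachExp

/-! ### Binomial smoothing -/

section Binomial

variable {A : Type*} [NormedCommRing A] [NormedAlgebra ℝ A] [NormOneClass A]

theorem sum_choose_mul_sq (n : ℕ) :
    ∑ k ∈ Finset.range (n + 1), (n.choose k : ℝ) * ((n : ℝ) - 2 * k) ^ 2 = (n : ℝ) * 2 ^ n := by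
  have h := congrArg (Polynomial.eval (1 / 2 : ℝ)) (bernsteinPolynomial.variance ℝ n)
  rw [Polynomial.eval_finsetSum] at h
  have e : ∀ k ∈ Finset.range (n + 1), Polynomial.eval (1 / 2 : ℝ)
      ((n • Polynomial.X - (k : Polynomial ℝ)) ^ 2 * bernsteinPolynomial ℝ n k) =
      ((n.choose k : ℝ) * ((n : ℝ) - 2 * k) ^ 2) * (1 / 4 * (1 / 2) ^ n) := by
    intro k hk
    have hk' : k ≤ n := by simpa [Nat.lt_succ_iff] using hk
    simp only [bernsteinPolynomial, Polynomial.eval_mul, Polynomial.eval_pow, Polynomial.eval_sub,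
      Polynomial.eval_natCast, Polynomial.eval_X, Polynomial.eval_one, nsmul_eq_mul]
    have : (1 / 2 : ℝ) ^ n = (1 / 2) ^ k * (1 - 1 / 2) ^ (n - k) := by
      rw [show (1 - 1 / 2 : ℝ) = 1 / 2 by norm_num, ← pow_add]
      congr 1
      omega
    rw [this]
    ring
  rw [Finset.sum_congr rfl e, ← Finset.sum_mul] at h
  simp only [Polynomial.eval_mul, Polynomial.eval_sub, Polynomial.eval_X,
    Polynomial.eval_one, nsmul_eq_mul, Polynomial.eval_natCast] at h
  have h2 : (1 / 2 : ℝ) ^ n * 2 ^ n = 1 := by rw [← mul_pow]; norm_num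
  linear_combination (4 * (2 : ℝ) ^ n) * h - (∑ k ∈ Finset.range (n + 1),
    (n.choose k : ℝ) * ((n : ℝ) - 2 * k) ^ 2) * h2

/-- Consecutive binomial coefficients of order m differ by C(m+1, k)(m+1-2k)/(m+1). The norm thus
reduces to a first absolute deviation of the symmetric binomial law, which its variance controls. -/
theorem one_sub_mul_one_add_pow (u : A) (m : ℕ) :
    (m + 1 : ℝ) • ((1 - u) * (1 + u) ^ m) =
      ∑ k ∈ Finset.range (m + 2), (((m + 1).choose k : ℝ) * ((m + 1 : ℕ) - 2 * k)) • u ^ k := by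
  have h1 : (1 + u) ^ (m + 1) = ∑ k ∈ Finset.range (m + 2), ((m + 1).choose k : ℝ) • u ^ k := by
    rw [add_comm, add_pow]
    refine Finset.sum_congr rfl fun k _ => ?_
    rw [one_pow, mul_one, mul_comm, Nat.cast_smul_eq_nsmul, nsmul_eq_mul]
  have h2 : (m + 1 : ℝ) • (u * (1 + u) ^ m) =
      ∑ k ∈ Finset.range (m + 2), (((m + 1).choose k : ℝ) * k) • u ^ k := by
    rw [Finset.sum_range_succ']
    simp only [Nat.cast_zero, mul_zero, zero_smul, add_zero]
    rw [add_comm 1 u, add_pow, Finset.mul_sum, Finset.smul_sum]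
    refine Finset.sum_congr rfl fun k _ => ?_
    have h := Nat.add_one_mul_choose_eq m k
    have h' : ((m + 1).choose (k + 1) : ℝ) * ((k + 1 : ℕ) : ℝ) = (m + 1) * m.choose k := by
      exact_mod_cast h.symm
    rw [h', one_pow, mul_one, mul_smul, pow_succ', Nat.cast_smul_eq_nsmul, nsmul_eq_mul]
    congr 1
    ring
  have e : (m + 1 : ℝ) • ((1 - u) * (1 + u) ^ m) =
      (m + 1 : ℝ) • (1 + u) ^ (m + 1) - (2 : ℝ) • ((m + 1 : ℝ) • (u * (1 + u) ^ m)) := by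
    rw [two_smul, ← smul_add, ← smul_sub]
    congr 1
    ring
  rw [e, h1, h2, Finset.smul_sum, Finset.smul_sum, ← Finset.sum_sub_distrib]
  refine Finset.sum_congr rfl fun k _ => ?_
  rw [smul_smul, smul_smul, ← sub_smul]
  congr 1
  push_cast
  ring

/-- Powers of the lazy walk smooth the difference operator. -/
theorem norm_one_sub_mul_one_add_pow_le {u : A} (hu : ‖u‖ ≤ 1) (m : ℕ) :
    ‖(1 - u) * (1 + u) ^ m‖ ≤ 2 * 2 ^ m / √(m + 1) := by
  have hm : (0 : ℝ) < m + 1 := by positivity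
  have hs : 0 < √(m + 1 : ℝ) := Real.sqrt_pos.2 hm
  have hsq : √(m + 1 : ℝ) ^ 2 = m + 1 := Real.sq_sqrt hm.le
  have key : (m + 1) * ‖(1 - u) * (1 + u) ^ m‖ ≤ (m + 1) * (2 * 2 ^ m / √(m + 1)) := by
    calc (m + 1) * ‖(1 - u) * (1 + u) ^ m‖
        = ‖(m + 1 : ℝ) • ((1 - u) * (1 + u) ^ m)‖ := by rw [norm_smul, Real.norm_of_nonneg hm.le]
      _ ≤ ∑ k ∈ Finset.range (m + 2), ((m + 1).choose k : ℝ) * |((m + 1 : ℕ) : ℝ) - 2 * k| := by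
          rw [one_sub_mul_one_add_pow]
          refine norm_sum_le_of_le _ fun k _ => ?_
          rw [norm_smul, norm_mul, Real.norm_natCast, Real.norm_eq_abs]
          exact mul_le_of_le_one_right (by positivity)
            ((norm_pow_le u k).trans (pow_le_one₀ (norm_nonneg _) hu))
      _ ≤ ∑ k ∈ Finset.range (m + 2), (((m + 1).choose k : ℝ) * (((m + 1 : ℕ) : ℝ) - 2 * k) ^ 2 *
            (1 / (2 * √(m + 1))) + ((m + 1).choose k : ℝ) * (√(m + 1) / 2)) := by
          refine Finset.sum_le_sum fun k _ => ?_
          rw [mul_assoc, ← mul_add]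
          gcongr
          generalize ((m + 1 : ℕ) : ℝ) - 2 * k = y
          rw [← sq_abs y]
          have : |y| ^ 2 * (1 / (2 * √(m + 1 : ℝ))) + √(m + 1) / 2 =
              (|y| ^ 2 + √(m + 1 : ℝ) ^ 2) / (2 * √(m + 1)) := by field_simp
          rw [this, le_div_iff₀ (by positivity)]
          nlinarith [sq_nonneg (|y| - √(m + 1 : ℝ))]
      _ = (m + 1) * (2 * 2 ^ m / √(m + 1)) := by
          rw [Finset.sum_add_distrib, ← Finset.sum_mul, ← Finset.sum_mul, sum_choose_mul_sq,
            ← Nat.cast_sum, Nat.sum_range_choose]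
          push_cast
          field_simp
          rw [hsq]
          ring
  exact le_of_mul_le_mul_left key hm

end Binomial

/-! ### Smoothing of the generator of a symmetric walk -/

section Smoothing

open NormedSpace

variable {A : Type*} [NormedCommRing A] [NormedAlgebra ℝ A] [NormOneClass A]

/-- The symmetric average of two elements. -/
noncomputable def symmAvg (u v : A) : A := (1 / 2 : ℝ) • (u + v)

theorem norm_symmAvg_le {u v : A} (hu : ‖u‖ ≤ 1) (hv : ‖v‖ ≤ 1) : ‖symmAvg u v‖ ≤ 1 := by
  rw [symmAvg, norm_smul, Real.norm_of_nonneg (by norm_num)]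
  linarith [norm_add_le u v]

/-- This factorisation into two first differences doubles the smoothing exponent: each factor decays
like the inverse square root of time, the product like its inverse. -/
theorem symmAvg_sub_one {u v : A} (huv : u * v = 1) :
    symmAvg u v - 1 = (-1 / 2 : ℝ) • ((1 - u) * (1 - v)) := by
  have h : (1 - u) * (1 - v) = 1 + 1 - (u + v) := by linear_combination huv
  rw [h, symmAvg, smul_sub, smul_add]
  module

theorem one_add_symmAvg {u v : A} (huv : u * v = 1) :
    (1 / 2 : ℝ) • (1 + symmAvg u v) = (1 / 4 : ℝ) • ((1 + u) * (1 + v)) := by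
  have h : (1 + u) * (1 + v) = 1 + 1 + (u + v) := by linear_combination huv
  rw [h, symmAvg]
  module

theorem norm_symmAvg_sub_one_mul_exp_le [CompleteSpace A] {u v : A} (huv : u * v = 1)
    (hu : ‖u‖ ≤ 1) (hv : ‖v‖ ≤ 1) {a : ℝ} (ha : 0 < a) :
    ‖(symmAvg u v - 1) * exp (a • (symmAvg u v - 1))‖ ≤ 1 / a := by
  have h : a • (symmAvg u v - 1) = (a / 2) • (u - 1) + (a / 2) • (v - 1) := by
    rw [symmAvg]
    module
  have e : (symmAvg u v - 1) * exp (a • (symmAvg u v - 1)) = (-1 / 2 : ℝ) •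
      (((1 - u) * exp ((a / 2) • (u - 1))) * ((1 - v) * exp ((a / 2) • (v - 1)))) := by
    rw [h, banach_exp_add, symmAvg_sub_one huv, smul_mul_assoc]
    congr 1
    ring
  have ha2 : 0 < a / 2 := by positivity
  have hs : √(a / 2) * √(a / 2) = a / 2 := Real.mul_self_sqrt ha2.le
  rw [e, norm_smul]
  calc ‖(-1 / 2 : ℝ)‖ * ‖((1 - u) * exp ((a / 2) • (u - 1))) *
        ((1 - v) * exp ((a / 2) • (v - 1)))‖
      ≤ 1 / 2 * (1 / √(a / 2) * (1 / √(a / 2))) := by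
        gcongr
        · rw [Real.norm_eq_abs]; norm_num [abs_div]
        · refine (norm_mul_le _ _).trans ?_
          gcongr
          · exact norm_one_sub_mul_exp_le hu ha2
          · exact norm_one_sub_mul_exp_le hv ha2
    _ = 1 / a := by
        rw [div_mul_div_comm, hs]
        field_simp

theorem norm_symmAvg_sub_one_mul_lazy_pow_le {u v : A} (huv : u * v = 1)
    (hu : ‖u‖ ≤ 1) (hv : ‖v‖ ≤ 1) (m : ℕ) :
    ‖(symmAvg u v - 1) * ((1 / 2 : ℝ) • (1 + symmAvg u v)) ^ m‖ ≤ 2 / (m + 1) := by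
  have e : (symmAvg u v - 1) * ((1 / 2 : ℝ) • (1 + symmAvg u v)) ^ m =
      ((-1 / 2 : ℝ) * (1 / 4) ^ m) • (((1 - u) * (1 + u) ^ m) * ((1 - v) * (1 + v) ^ m)) := by
    rw [one_add_symmAvg huv, symmAvg_sub_one huv, smul_pow, smul_mul_smul_comm, mul_pow]
    congr 1
    ring
  have hm : (0 : ℝ) < m + 1 := by positivity
  have hs : √(m + 1 : ℝ) * √(m + 1 : ℝ) = m + 1 := Real.mul_self_sqrt hm.le
  rw [e, norm_smul]
  calc ‖(-1 / 2 : ℝ) * (1 / 4) ^ m‖ * ‖((1 - u) * (1 + u) ^ m) * ((1 - v) * (1 + v) ^ m)‖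
      ≤ (1 / 2 * (1 / 4) ^ m) * ((2 * 2 ^ m / √(m + 1)) * (2 * 2 ^ m / √(m + 1))) := by
        gcongr
        · rw [norm_mul, Real.norm_of_nonneg (show (0 : ℝ) ≤ (1 / 4) ^ m by positivity),
            Real.norm_eq_abs]
          gcongr
          norm_num [abs_div]
        · refine (norm_mul_le _ _).trans ?_
          gcongr
          · exact norm_one_sub_mul_one_add_pow_le hu m
          · exact norm_one_sub_mul_one_add_pow_le hv m
    _ = 2 / (m + 1) := by
        rw [div_mul_div_comm, hs]
        have h4 : (1 / 4 : ℝ) ^ m * (2 ^ m * 2 ^ m) = 1 := by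
          rw [← mul_pow, ← mul_pow]
          norm_num
        rw [← mul_div_assoc]
        congr 1
        linear_combination 2 * h4

/-- Smoothing at rate `1 / m` survives mixing with a power-bounded element. -/
theorem norm_mul_mixture_pow_le {L T B : A} {w : ℝ} (hw : 0 < w) (hw1 : w ≤ 1)
    (hB : ‖B‖ ≤ 1 - w) (hL : ∀ m : ℕ, ‖L * T ^ m‖ ≤ 2 / (m + 1)) (k : ℕ) :
    ‖L * (w • T + B) ^ k‖ ≤ 2 / (w * (k + 1)) := by
  have hk : (0 : ℝ) < k + 1 := by positivity
  have key : ‖L * (w • T + B) ^ k‖ * (w * (k + 1)) ≤ 2 := by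
    calc ‖L * (w • T + B) ^ k‖ * (w * (k + 1))
        ≤ (∑ m ∈ Finset.range (k + 1), w ^ m * (2 / (m + 1)) * (1 - w) ^ (k - m) * k.choose m) *
            (w * (k + 1)) := by
          gcongr
          rw [add_pow, Finset.mul_sum]
          refine norm_sum_le_of_le _ fun m _ => ?_
          have e : L * ((w • T) ^ m * B ^ (k - m) * (k.choose m : A)) =
              (w ^ m * (k.choose m : ℝ)) • ((L * T ^ m) * B ^ (k - m)) := by
            rw [smul_pow, mul_smul, Nat.cast_smul_eq_nsmul, nsmul_eq_mul, smul_mul_assoc,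
              smul_mul_assoc, mul_smul_comm]
            congr 1
            ring
          have hB' : ‖B ^ (k - m)‖ ≤ (1 - w) ^ (k - m) :=
            (norm_pow_le _ _).trans (pow_le_pow_left₀ (norm_nonneg _) hB _)
          rw [e, norm_smul, Real.norm_of_nonneg (by positivity)]
          calc w ^ m * (k.choose m : ℝ) * ‖L * T ^ m * B ^ (k - m)‖
              ≤ w ^ m * (k.choose m : ℝ) * (2 / (m + 1) * (1 - w) ^ (k - m)) := by
                gcongr
                refine (norm_mul_le _ _).trans ?_
                gcongr
                exact hL m
            _ = _ := by ring
      -- The factor 1/(m+1) is absorbed by C(k, m)/(m+1) = C(k+1, m+1)/(k+1). What remains is a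
      -- binomial expansion of order k+1 without its zeroth term.
      _ = 2 * ∑ m ∈ Finset.range (k + 1),
            w ^ (m + 1) * (1 - w) ^ (k + 1 - (m + 1)) * (k + 1).choose (m + 1) := by
          rw [Finset.sum_mul, Finset.mul_sum]
          refine Finset.sum_congr rfl fun m _ => ?_
          have h := Nat.add_one_mul_choose_eq k m
          have h' : ((k + 1).choose (m + 1) : ℝ) = (k + 1) * k.choose m / (m + 1) := by
            rw [eq_div_iff (by positivity)]
            exact_mod_cast h.symm
          rw [h', Nat.add_sub_add_right, pow_succ]
          field_simp
      _ ≤ 2 * ∑ m ∈ Finset.range (k + 1 + 1),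
            w ^ m * (1 - w) ^ (k + 1 - m) * (k + 1).choose m := by
          rw [Finset.sum_range_succ' _ (k + 1)]
          gcongr
          have : 0 ≤ 1 - w := by linarith
          have : 0 ≤ w ^ 0 * (1 - w) ^ (k + 1 - 0) * ((k + 1).choose 0 : ℝ) := by positivity
          linarith
      _ = 2 := by rw [← add_pow]; simp
  rwa [le_div_iff₀ (by positivity)]

/-- The square of a mixture of `1`, a symmetric average and a remainder contains a lazy walk. -/
theorem norm_sq_sub_lazy_le {u v R : A} (huv : u * v = 1) (hu : ‖u‖ ≤ 1)
    (hv : ‖v‖ ≤ 1) {q p ρ : ℝ} (hq : 0 ≤ q) (hp : 0 ≤ p) (hsum : q + p + ρ = 1) (hR : ‖R‖ ≤ ρ) :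
    ‖(q • 1 + p • symmAvg u v + R) ^ 2 - (2 * q * p) • ((1 / 2 : ℝ) • (1 + symmAvg u v))‖ ≤
      1 - 2 * q * p := by
  have hS := norm_symmAvg_le hu hv
  set S := symmAvg u v with hSdef
  have hρ : 0 ≤ ρ := (norm_nonneg _).trans hR
  have hS2 : S ^ 2 = (1 / 2 : ℝ) • 1 + (1 / 4 : ℝ) • (u ^ 2 + v ^ 2) := by
    have : (u + v) ^ 2 = (2 : ℝ) • 1 + (u ^ 2 + v ^ 2) := by
      rw [two_smul]
      linear_combination 2 * huv
    rw [hSdef, symmAvg, smul_pow, this]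
    module
  -- The lazy part takes qp from the cross term 2qp S and qp from the identity, whose weight is q^2
  -- + p^2/2 because S^2 has identity part 1/2. As q^2 + p^2/2 ≥ qp, all remaining weights are
  -- nonnegative and the norm is at most their total.
  have e : (q • 1 + p • S + R) ^ 2 - (2 * q * p) • ((1 / 2 : ℝ) • (1 + S)) =
      (q ^ 2 + p ^ 2 / 2 - q * p) • (1 : A) + (p ^ 2 / 4) • (u ^ 2 + v ^ 2) + (q * p) • S +
        ((2 : ℝ) • ((q • 1 + p • S) * R) + R ^ 2) := by
    have : (q • 1 + p • S + R) ^ 2 = q ^ 2 • (1 : A) + p ^ 2 • S ^ 2 + (2 * q * p) • S +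
        ((2 : ℝ) • ((q • 1 + p • S) * R) + R ^ 2) := by
      simp only [Algebra.smul_def, map_mul, map_pow, map_ofNat]
      ring
    rw [this, hS2]
    module
  have hc : 0 ≤ q ^ 2 + p ^ 2 / 2 - q * p := by nlinarith [sq_nonneg (q - p)]
  have h1 : ‖(q ^ 2 + p ^ 2 / 2 - q * p) • (1 : A)‖ ≤ q ^ 2 + p ^ 2 / 2 - q * p := by
    rw [norm_smul, norm_one, mul_one, Real.norm_of_nonneg hc]
  have h2 : ‖(p ^ 2 / 4) • (u ^ 2 + v ^ 2)‖ ≤ p ^ 2 / 2 := by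
    rw [norm_smul, Real.norm_of_nonneg (by positivity)]
    have hu2 : ‖u ^ 2‖ ≤ 1 := (norm_pow_le _ _).trans (pow_le_one₀ (norm_nonneg _) hu)
    have hv2 : ‖v ^ 2‖ ≤ 1 := (norm_pow_le _ _).trans (pow_le_one₀ (norm_nonneg _) hv)
    have := (norm_add_le (u ^ 2) (v ^ 2))
    nlinarith [sq_nonneg p]
  have h3 : ‖(q * p) • S‖ ≤ q * p := by
    rw [norm_smul, Real.norm_of_nonneg (by positivity)]
    exact mul_le_of_le_one_right (by positivity) hS
  have h4 : ‖(2 : ℝ) • ((q • 1 + p • S) * R)‖ ≤ 2 * ((q + p) * ρ) := by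
    rw [norm_smul, Real.norm_of_nonneg zero_le_two]
    gcongr
    refine (norm_mul_le _ _).trans ?_
    gcongr
    refine (norm_add_le _ _).trans ?_
    rw [norm_smul, norm_smul, norm_one, Real.norm_of_nonneg hq, Real.norm_of_nonneg hp]
    nlinarith
  have h5 : ‖R ^ 2‖ ≤ ρ ^ 2 := (norm_pow_le _ _).trans (pow_le_pow_left₀ (norm_nonneg _) hR _)
  rw [e]
  refine (norm_add₄_le.trans (add_le_add (add_le_add (add_le_add h1 h2) h3)
    ((norm_add_le _ _).trans (add_le_add h4 h5)))).trans (le_of_eq ?_)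
  have : ρ = 1 - q - p := by linarith
  rw [this]
  ring

/-- The lazy weight 2qp is proportional to p, so the prefactor p cancels and rarely taken directions
cost nothing extra. -/
theorem norm_smul_symmAvg_sub_one_mul_pow_le {u v R : A} (huv : u * v = 1) (hu : ‖u‖ ≤ 1)
    (hv : ‖v‖ ≤ 1) {q p ρ : ℝ} (hq : 0 < q) (hp : 0 ≤ p) (hsum : q + p + ρ = 1) (hR : ‖R‖ ≤ ρ)
    (k : ℕ) :
    ‖(p • (symmAvg u v - 1)) * (q • 1 + p • symmAvg u v + R) ^ (2 * k)‖ ≤ 1 / (q * (k + 1)) := by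
  rcases hp.eq_or_lt with rfl | hp
  · rw [zero_smul, zero_mul, norm_zero]
    positivity
  have hρ : 0 ≤ ρ := (norm_nonneg _).trans hR
  have h := norm_mul_mixture_pow_le (w := 2 * q * p) (by positivity)
    (by nlinarith [sq_nonneg (q - p)])
    (norm_sq_sub_lazy_le huv hu hv hq.le hp.le hsum hR)
    (norm_symmAvg_sub_one_mul_lazy_pow_le huv hu hv) k
  rw [add_sub_cancel, ← pow_mul] at h
  rw [smul_mul_assoc, norm_smul, Real.norm_of_nonneg hp.le]
  calc p * _ ≤ p * (2 / (2 * q * p * (k + 1))) := by gcongr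
    _ = 1 / (q * (k + 1)) := by field_simp

variable [CompleteSpace A]

theorem norm_exp_smul_sub_smul_one_le {T : A} {c : ℝ} (hT : ‖T‖ ≤ c) {a : ℝ} (ha : 0 ≤ a) :
    ‖exp (a • (T - c • 1))‖ ≤ 1 := by
  rcases ((norm_nonneg T).trans hT).eq_or_lt with rfl | hc
  · have : T = 0 := norm_le_zero_iff.1 hT
    simp [this]
  · have e : a • (T - c • 1) = (a * c) • ((1 / c) • T - 1) := by
      rw [mul_smul, smul_sub c, smul_smul, mul_one_div_cancel hc.ne', one_smul]
    rw [e]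
    refine norm_exp_smul_sub_one_le ?_ (by positivity)
    rw [norm_smul, Real.norm_of_nonneg (by positivity), one_div_mul_eq_div]
    exact (div_le_one hc).2 hT

variable (A) in
/-- A lazy symmetric random walk in a commutative Banach algebra: steps `u i`, `v i = (u i)⁻¹` of
norm at most one are taken with total probability `p i`, and the walk stays with probability
`q > 0`. -/
structure SymmetricWalk (ι : Type*) [Fintype ι] where
  /-- the forward steps -/
  u : ι → A
  /-- the backward steps -/
  v : ι → A
  /-- the probability of moving in the `i`th direction -/
  p : ι → ℝ
  /-- the probability of staying -/
  q : ℝ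
  mul_eq_one : ∀ i, u i * v i = 1
  norm_u_le : ∀ i, ‖u i‖ ≤ 1
  norm_v_le : ∀ i, ‖v i‖ ≤ 1
  p_nonneg : ∀ i, 0 ≤ p i
  q_pos : 0 < q
  add_sum_eq_one : q + ∑ i, p i = 1

namespace SymmetricWalk

variable {ι : Type*} [Fintype ι] (W : SymmetricWalk A ι)

/-- The generator `F - 1` of a symmetric walk with one-step element `F`. -/
noncomputable def gen : A := ∑ i, W.p i • (symmAvg (W.u i) (W.v i) - 1)

theorem norm_sum_erase_le [DecidableEq ι] (i : ι) :
    ‖∑ j ∈ Finset.univ.erase i, W.p j • symmAvg (W.u j) (W.v j)‖ ≤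
      ∑ j ∈ Finset.univ.erase i, W.p j := by
  refine norm_sum_le_of_le _ fun j _ => ?_
  rw [norm_smul, Real.norm_of_nonneg (W.p_nonneg j)]
  exact mul_le_of_le_one_right (W.p_nonneg j)
    (norm_symmAvg_le (W.norm_u_le j) (W.norm_v_le j))

theorem one_add_gen : 1 + W.gen = W.q • 1 + ∑ i, W.p i • symmAvg (W.u i) (W.v i) := by
  have h : (1 : A) = (W.q + ∑ i, W.p i) • (1 : A) := by rw [W.add_sum_eq_one, one_smul]
  rw [gen]
  simp only [smul_sub, Finset.sum_sub_distrib]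
  nth_rewrite 1 [h]
  rw [add_smul, Finset.sum_smul]
  abel

theorem one_add_gen_eq [DecidableEq ι] (i : ι) :
    1 + W.gen = W.q • 1 + W.p i • symmAvg (W.u i) (W.v i) +
      ∑ j ∈ Finset.univ.erase i, W.p j • symmAvg (W.u j) (W.v j) := by
  rw [one_add_gen, add_assoc,
    Finset.add_sum_erase _ (fun j => W.p j • symmAvg (W.u j) (W.v j)) (Finset.mem_univ i)]

theorem norm_sum_le : ‖∑ i, W.p i • symmAvg (W.u i) (W.v i)‖ ≤ 1 - W.q := by
  have h : ‖∑ i, W.p i • symmAvg (W.u i) (W.v i)‖ ≤ ∑ i, W.p i := by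
    refine norm_sum_le_of_le _ fun j _ => ?_
    rw [norm_smul, Real.norm_of_nonneg (W.p_nonneg j)]
    exact mul_le_of_le_one_right (W.p_nonneg j)
      (norm_symmAvg_le (W.norm_u_le j) (W.norm_v_le j))
  linarith [W.add_sum_eq_one]

theorem norm_one_add_gen_le : ‖1 + W.gen‖ ≤ 1 := by
  rw [one_add_gen]
  refine (norm_add_le _ _).trans ?_
  rw [norm_smul, norm_one, Real.norm_of_nonneg W.q_pos.le]
  linarith [W.norm_sum_le]

theorem norm_gen_le : ‖W.gen‖ ≤ 2 := by
  have e : W.gen = (1 + W.gen) - 1 := by ring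
  rw [e]
  refine (norm_sub_le _ _).trans ?_
  rw [norm_one]
  linarith [W.norm_one_add_gen_le]

theorem norm_exp_smul_gen_le {a : ℝ} (ha : 0 ≤ a) : ‖exp (a • W.gen)‖ ≤ 1 := by
  have e : W.gen = (1 + W.gen) - 1 := by ring
  rw [e]
  exact norm_exp_smul_sub_one_le W.norm_one_add_gen_le ha

/-- The powers of a symmetric walk smooth its generator at rate `1 / n`. -/
theorem norm_gen_mul_pow_le (n : ℕ) :
    ‖W.gen * (1 + W.gen) ^ n‖ ≤ 2 * Fintype.card ι / (W.q * (n + 1)) := by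
  classical
  have hq := W.q_pos
  have h1 : ‖W.gen * (1 + W.gen) ^ (2 * (n / 2))‖ ≤
      ∑ _i : ι, 1 / (W.q * ((n / 2 : ℕ) + 1)) := by
    nth_rewrite 1 [gen]
    rw [Finset.sum_mul]
    refine norm_sum_le_of_le _ fun i _ => ?_
    rw [W.one_add_gen_eq i]
    refine norm_smul_symmAvg_sub_one_mul_pow_le (W.mul_eq_one i) (W.norm_u_le i) (W.norm_v_le i)
      hq (W.p_nonneg i) ?_ (W.norm_sum_erase_le i) _
    rw [add_assoc, Finset.add_sum_erase _ _ (Finset.mem_univ i), W.add_sum_eq_one]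
  have h2 : (1 + W.gen) ^ n = (1 + W.gen) ^ (2 * (n / 2)) * (1 + W.gen) ^ (n % 2) := by
    rw [← pow_add, Nat.div_add_mod]
  have h3 : ‖(1 + W.gen) ^ (n % 2)‖ ≤ 1 :=
    (norm_pow_le _ _).trans (pow_le_one₀ (norm_nonneg _) W.norm_one_add_gen_le)
  have h4 : (n : ℝ) + 1 ≤ 2 * ((n / 2 : ℕ) + 1) := by
    have : n + 1 ≤ 2 * (n / 2 + 1) := by omega
    exact_mod_cast this
  rw [h2, ← mul_assoc]
  calc _ ≤ (∑ _i : ι, 1 / (W.q * ((n / 2 : ℕ) + 1))) * 1 := by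
        refine (norm_mul_le _ _).trans ?_
        gcongr
    _ = 2 * Fintype.card ι / (W.q * (2 * ((n / 2 : ℕ) + 1))) := by
        rw [Finset.sum_const, Finset.card_univ, nsmul_eq_mul]
        field_simp
    _ ≤ _ := by gcongr

/-- The compound Poisson semigroup of a symmetric walk smooths its generator at rate `1 / a`. -/
theorem norm_gen_mul_exp_le {a : ℝ} (ha : 0 < a) :
    ‖W.gen * exp (a • W.gen)‖ ≤ Fintype.card ι / a := by
  classical
  have h1 : ‖W.gen * exp (a • W.gen)‖ ≤ ∑ _i : ι, 1 / a := by
    nth_rewrite 1 [gen]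
    rw [Finset.sum_mul]
    refine norm_sum_le_of_le _ fun i _ => ?_
    rcases (W.p_nonneg i).eq_or_lt with h0 | h0
    · rw [← h0, zero_smul, zero_mul, norm_zero]
      positivity
    -- Direction i runs for time a p_i and yields 1/(a p_i), cancelling the weight p_i. The other
    -- directions form a factor of norm at most one.
    have e : a • W.gen = (a * W.p i) • (symmAvg (W.u i) (W.v i) - 1) +
        a • (∑ j ∈ Finset.univ.erase i, W.p j • symmAvg (W.u j) (W.v j) -
          (∑ j ∈ Finset.univ.erase i, W.p j) • 1) := by
      rw [gen, ← Finset.add_sum_erase _ _ (Finset.mem_univ i), smul_add, smul_smul,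
        Finset.sum_smul, ← Finset.sum_sub_distrib]
      simp only [smul_sub]
    rw [e, banach_exp_add, ← mul_assoc, smul_mul_assoc, smul_mul_assoc, norm_smul,
      Real.norm_of_nonneg h0.le]
    calc _ ≤ W.p i * (1 / (a * W.p i) * 1) := by
          gcongr
          refine (norm_mul_le _ _).trans ?_
          gcongr
          · exact norm_symmAvg_sub_one_mul_exp_le (W.mul_eq_one i) (W.norm_u_le i)
              (W.norm_v_le i) (by positivity)
          · exact norm_exp_smul_sub_smul_one_le (W.norm_sum_erase_le i) ha.le
      _ = 1 / a := by field_simp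
  refine h1.trans (le_of_eq ?_)
  rw [Finset.sum_const, Finset.card_univ, nsmul_eq_mul]
  ring

end SymmetricWalk

end Smoothing

/-! ### Wiener norm bounds from L² norms on the circle -/

section WienerNorm

open Polynomial Filter Topology

/-- A telescoping bound for a Cauchy-type weight around a real centre. -/
theorem weight_le_sub {σ : ℝ} (hσ : 1 ≤ σ) (x : ℝ) :
    σ / (σ + |x|) ^ 2 ≤ 2 * ((x + 1) / (σ + |x + 1|) - x / (σ + |x|)) := by
  have hx : 0 < σ + |x| := by positivity
  have hx1 : 0 < σ + |x + 1| := by positivity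
  rw [div_sub_div _ _ hx1.ne' hx.ne', ← mul_div_assoc, div_le_div_iff₀ (by positivity)
    (by positivity)]
  rcases le_total 0 x with h | h
  · rw [abs_of_nonneg h, abs_of_nonneg (by linarith : 0 ≤ x + 1)]
    have h1 : 0 ≤ σ * (σ + x) * ((σ + x) - 1) := by
      have : 0 ≤ σ + x - 1 := by linarith
      positivity
    nlinarith
  · rw [abs_of_nonpos h]
    have hp : 0 ≤ σ - x := by linarith
    rcases le_total 0 (x + 1) with h1 | h1
    · rw [abs_of_nonneg h1]
      have a1 : 0 ≤ -x * (x + 1) := mul_nonneg (by linarith) h1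
      have a2 : σ * (σ + (x + 1)) ≤ 2 * (σ + 2 * (-x * (x + 1))) * (σ + -x) := by
        nlinarith [mul_nonneg a1 hp, mul_nonneg (by linarith : 0 ≤ σ) hp]
      calc σ * ((σ + (x + 1)) * (σ + -x)) = (σ * (σ + (x + 1))) * (σ + -x) := by ring
        _ ≤ (2 * (σ + 2 * (-x * (x + 1))) * (σ + -x)) * (σ + -x) := by
            apply mul_le_mul_of_nonneg_right a2; linarith
        _ = _ := by ring
    · rw [abs_of_nonpos h1]
      have a2 : σ + -(x + 1) ≤ 2 * (σ + -x) := by linarith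
      calc σ * ((σ + -(x + 1)) * (σ + -x)) = (σ * (σ + -x)) * (σ + -(x + 1)) := by ring
        _ ≤ (σ * (σ + -x)) * (2 * (σ + -x)) := by
            apply mul_le_mul_of_nonneg_left a2
            apply mul_nonneg <;> linarith
        _ = _ := by ring

/-- The weights are dominated by increments of 2x/(σ + |x|), a function with values in [-2, 2]. -/
theorem sum_weight_le {σ : ℝ} (hσ : 1 ≤ σ) (μ : ℝ) (s : Finset ℕ) :
    ∑ m ∈ s, σ / (σ + |(m : ℝ) - μ|) ^ 2 ≤ 4 := by
  obtain ⟨M, hM⟩ := s.exists_nat_subset_range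
  let φ : ℝ → ℝ := fun x => x / (σ + |x|)
  have hφ : ∀ x, |φ x| ≤ 1 := fun x => by
    have hx : 0 < σ + |x| := by positivity
    simp only [φ]
    rw [abs_div, abs_of_pos hx, div_le_one hx]
    linarith
  calc ∑ m ∈ s, σ / (σ + |(m : ℝ) - μ|) ^ 2
      ≤ ∑ m ∈ Finset.range M, σ / (σ + |(m : ℝ) - μ|) ^ 2 :=
        Finset.sum_le_sum_of_subset_of_nonneg hM fun _ _ _ => by positivity
    _ ≤ ∑ m ∈ Finset.range M, 2 * (φ ((m + 1 : ℕ) - μ) - φ ((m : ℝ) - μ)) := by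
        refine Finset.sum_le_sum fun m _ => ?_
        have h := weight_le_sub hσ ((m : ℝ) - μ)
        have e : (m : ℝ) - μ + 1 = ((m + 1 : ℕ) : ℝ) - μ := by push_cast; ring
        rwa [e] at h
    _ = 2 * (φ (M - μ) - φ ((0 : ℕ) - μ)) := by
        rw [← Finset.mul_sum, Finset.sum_range_sub fun m : ℕ => φ ((m : ℝ) - μ)]
    _ ≤ 4 := by
        have h1 := abs_le.1 (hφ (M - μ))
        have h2 := abs_le.1 (hφ ((0 : ℕ) - μ))
        linarith

/-- Cauchy-Schwarz against the weight σ/(σ + |m - μ|)^2. Its mass is at most 4, and (σ + |y|)^2 ≤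
2(σ^2 + y^2) supplies the other factor 2. -/
theorem sq_sum_abs_le {σ : ℝ} (hσ : 1 ≤ σ) (μ : ℝ) (s : Finset ℕ) (c : ℕ → ℝ) :
    (∑ m ∈ s, |c m|) ^ 2 ≤
      8 * (σ * ∑ m ∈ s, c m ^ 2 + σ⁻¹ * ∑ m ∈ s, (((m : ℝ) - μ) * c m) ^ 2) := by
  have hσ0 : 0 < σ := by linarith
  have h1 := Finset.sum_sq_le_sum_mul_sum_of_sq_le_mul s (r := fun m => |c m|)
    (f := fun m : ℕ => σ / (σ + |(m : ℝ) - μ|) ^ 2)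
    (g := fun m : ℕ => c m ^ 2 * (σ + |(m : ℝ) - μ|) ^ 2 / σ)
    (fun m _ => by positivity) (fun m _ => by positivity) (fun m _ => by
      have : 0 < σ + |(m : ℝ) - μ| := by positivity
      rw [sq_abs]
      refine le_of_eq ?_
      field_simp)
  have h2 : ∑ m ∈ s, c m ^ 2 * (σ + |(m : ℝ) - μ|) ^ 2 / σ ≤
      2 * (σ * ∑ m ∈ s, c m ^ 2 + σ⁻¹ * ∑ m ∈ s, (((m : ℝ) - μ) * c m) ^ 2) := by
    rw [Finset.mul_sum, Finset.mul_sum, ← Finset.sum_add_distrib, Finset.mul_sum]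
    refine Finset.sum_le_sum fun m _ => ?_
    rw [div_le_iff₀ hσ0]
    have e : 2 * (σ * c m ^ 2 + σ⁻¹ * (((m : ℝ) - μ) * c m) ^ 2) * σ =
        c m ^ 2 * (2 * (σ ^ 2 + |(m : ℝ) - μ| ^ 2)) := by
      rw [sq_abs]
      field_simp
    rw [e]
    gcongr
    nlinarith [sq_nonneg (σ - |(m : ℝ) - μ|)]
  calc (∑ m ∈ s, |c m|) ^ 2 ≤ _ := h1
    _ ≤ 4 * (2 * (σ * ∑ m ∈ s, c m ^ 2 + σ⁻¹ * ∑ m ∈ s, (((m : ℝ) - μ) * c m) ^ 2)) := by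
        apply mul_le_mul (sum_weight_le hσ μ s) h2 (Finset.sum_nonneg fun m _ => by positivity)
          (by norm_num)
    _ = _ := by ring

variable {A : Type*} [NormedCommRing A] [NormedAlgebra ℝ A] [NormOneClass A]

theorem norm_aeval_le_sum_coeff {G : A} (hG : ‖G‖ ≤ 1) (P : ℝ[X]) :
    ‖aeval G P‖ ≤ ∑ m ∈ P.support, |P.coeff m| := by
  rw [aeval_def, eval₂_eq_sum, Polynomial.sum]
  refine norm_sum_le_of_le _ fun m _ => ?_
  rw [← Algebra.smul_def, norm_smul, Real.norm_eq_abs]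
  exact mul_le_of_le_one_right (abs_nonneg _)
    ((norm_pow_le _ _).trans (pow_le_one₀ (norm_nonneg _) hG))

theorem sum_sq_coeff_eq_circleAverage (P : ℝ[X]) {s : Finset ℕ} (hs : P.support ⊆ s) :
    ∑ m ∈ s, P.coeff m ^ 2 = Real.circleAverage (fun ζ => ‖aeval ζ P‖ ^ 2) 0 1 := by
  have h := (P.map (algebraMap ℝ ℂ)).sum_sq_norm_coeff_eq_circleAverage
  rw [support_map_of_injective _ (algebraMap ℝ ℂ).injective] at h
  simp only [eval_map_algebraMap] at h
  rw [← h]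
  refine (Finset.sum_subset hs fun m _ hm => ?_).symm.trans (Finset.sum_congr rfl fun m _ => ?_)
  · rw [notMem_support_iff.1 hm]
    norm_num
  · simp

/-- A Bernstein-type inequality: the Wiener norm is controlled by `L²` norms of a polynomial and of
its centred derivative. -/
theorem sq_norm_aeval_le {G : A} (hG : ‖G‖ ≤ 1) (P : ℝ[X]) {σ : ℝ} (hσ : 1 ≤ σ) (μ : ℝ) :
    ‖aeval G P‖ ^ 2 ≤ 8 * (σ * Real.circleAverage (fun ζ => ‖aeval ζ P‖ ^ 2) 0 1 +
      σ⁻¹ * Real.circleAverage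
        (fun ζ => ‖ζ * aeval ζ (derivative P) - μ * aeval ζ P‖ ^ 2) 0 1) := by
  have hco : ∀ m : ℕ, (X * derivative P - C μ * P).coeff m = ((m : ℝ) - μ) * P.coeff m := fun m => by
    cases m with
    | zero => simp
    | succ m =>
      simp only [coeff_sub, coeff_X_mul, coeff_derivative, coeff_C_mul]
      push_cast
      ring
  have h1 := sum_sq_coeff_eq_circleAverage P subset_rfl
  have h2 := sum_sq_coeff_eq_circleAverage (X * derivative P - C μ * P) (s := P.support)
    fun m hm => by
      rw [mem_support_iff] at hm ⊢
      rw [hco] at hm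
      exact right_ne_zero_of_mul hm
  simp only [hco, map_sub, map_mul, aeval_X, aeval_C, Complex.coe_algebraMap] at h2
  rw [← h1, ← h2]
  refine le_trans ?_ (sq_sum_abs_le hσ μ P.support P.coeff)
  gcongr
  exact norm_aeval_le_sum_coeff hG P

/-- Truncations of the exponential series of a polynomial. -/
noncomputable def expTrunc (W : ℝ[X]) (M : ℕ) : ℝ[X] :=
  ∑ j ∈ Finset.range M, C ((j.factorial : ℝ)⁻¹) * W ^ j

theorem aeval_expTrunc {B : Type*} [CommRing B] [Algebra ℝ B] (W : ℝ[X]) (M : ℕ) (x : B) :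
    aeval x (expTrunc W M) = ∑ j ∈ Finset.range M, ((j.factorial : ℝ)⁻¹) • aeval x W ^ j := by
  simp [expTrunc, Algebra.smul_def]

theorem derivative_expTrunc (W : ℝ[X]) (M : ℕ) :
    derivative (expTrunc W (M + 1)) = derivative W * expTrunc W M := by
  rw [expTrunc, Finset.sum_range_succ', expTrunc, derivative_add, derivative_sum, Finset.mul_sum]
  simp only [pow_zero, mul_one, derivative_C, add_zero]
  refine Finset.sum_congr rfl fun j _ => ?_
  rw [derivative_C_mul, derivative_pow, Nat.add_sub_cancel, Nat.factorial_succ]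
  have h : (((j + 1) * j.factorial : ℕ) : ℝ)⁻¹ * ((j + 1 : ℕ) : ℝ) = (j.factorial : ℝ)⁻¹ := by
    push_cast
    field_simp
  rw [← h, C_mul]
  ring

theorem tendsto_aeval_expTrunc [CompleteSpace A] (W : ℝ[X]) (x : A) :
    Tendsto (fun M => aeval x (expTrunc W M)) atTop (𝓝 (NormedSpace.exp (aeval x W))) := by
  simp only [aeval_expTrunc]
  exact (NormedSpace.exp_series_hasSum_exp' (𝕂 := ℝ) (aeval x W)).tendsto_sum_nat

theorem norm_aeval_expTrunc_le (W : ℝ[X]) (M : ℕ) (ζ : ℂ) :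
    ‖aeval ζ (expTrunc W M)‖ ≤ Real.exp ‖aeval ζ W‖ := by
  rw [aeval_expTrunc]
  refine (norm_sum_le_of_le _ fun j _ => ?_).trans
    (Real.sum_le_exp_of_nonneg (norm_nonneg (aeval ζ W)) M)
  rw [norm_smul, norm_pow, norm_inv, Real.norm_natCast, inv_mul_eq_div]

/-- The polynomial inequality is applied to truncated exponential series. The derivative of a
truncation is the derivative of the exponent times the previous truncation, so both circle averages
converge by domination. -/
theorem sq_norm_exp_aeval_le [CompleteSpace A] {G : A} (hG : ‖G‖ ≤ 1) (W : ℝ[X]) {σ : ℝ}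
    (hσ : 1 ≤ σ) (μ : ℝ) :
    ‖NormedSpace.exp (aeval G W)‖ ^ 2 ≤
      8 * (σ * Real.circleAverage (fun ζ => ‖Complex.exp (aeval ζ W)‖ ^ 2) 0 1 +
        σ⁻¹ * Real.circleAverage
          (fun ζ => ‖ζ * aeval ζ (derivative W) - μ‖ ^ 2 * ‖Complex.exp (aeval ζ W)‖ ^ 2) 0 1) := by
  have hexp : ∀ ζ : ℂ, Tendsto (fun M => aeval ζ (expTrunc W M)) atTop
      (𝓝 (Complex.exp (aeval ζ W))) := fun ζ => by
    rw [Complex.exp_eq_exp_ℂ]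
    exact tendsto_aeval_expTrunc W ζ
  have hc : ∀ Q : ℝ[X], Continuous fun θ : ℝ => aeval (circleMap 0 1 θ) Q := fun Q =>
    Q.continuous_aeval.comp (continuous_circleMap 0 1)
  have h0 : Tendsto (fun M => Real.circleAverage (fun ζ => ‖aeval ζ (expTrunc W (M + 1))‖ ^ 2) 0 1)
      atTop (𝓝 (Real.circleAverage (fun ζ => ‖Complex.exp (aeval ζ W)‖ ^ 2) 0 1)) := by
    unfold Real.circleAverage
    refine Tendsto.const_smul ?_ _
    refine intervalIntegral.tendsto_integral_filter_of_dominated_convergence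
      (fun θ => Real.exp ‖aeval (circleMap 0 1 θ) W‖ ^ 2)
      (Eventually.of_forall fun M => ?_) (Eventually.of_forall fun M => ?_) ?_ ?_
    · exact ((hc _).norm.pow 2).aestronglyMeasurable
    · refine Eventually.of_forall fun θ _ => ?_
      rw [norm_pow, norm_norm]
      gcongr
      exact norm_aeval_expTrunc_le _ _ _
    · exact ((Real.continuous_exp.comp (hc W).norm).pow 2).intervalIntegrable _ _
    · exact Eventually.of_forall fun θ _ =>
        (((hexp _).comp (tendsto_add_atTop_nat 1)).norm.pow 2)
  have h1 : Tendsto (fun M => Real.circleAverage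
      (fun ζ => ‖ζ * aeval ζ (derivative (expTrunc W (M + 1))) -
        μ * aeval ζ (expTrunc W (M + 1))‖ ^ 2) 0 1) atTop
      (𝓝 (Real.circleAverage
        (fun ζ => ‖ζ * aeval ζ (derivative W) - μ‖ ^ 2 * ‖Complex.exp (aeval ζ W)‖ ^ 2) 0 1)) := by
    unfold Real.circleAverage
    refine Tendsto.const_smul ?_ _
    refine intervalIntegral.tendsto_integral_filter_of_dominated_convergence
      (fun θ => ((‖circleMap 0 1 θ‖ * ‖aeval (circleMap 0 1 θ) (derivative W)‖ + |μ|) *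
        Real.exp ‖aeval (circleMap 0 1 θ) W‖) ^ 2)
      (Eventually.of_forall fun M => ?_) (Eventually.of_forall fun M => ?_) ?_ ?_
    · refine Continuous.aestronglyMeasurable ?_
      have := hc (derivative (expTrunc W (M + 1)))
      have := hc (expTrunc W (M + 1))
      have := continuous_circleMap 0 1
      fun_prop
    · refine Eventually.of_forall fun θ _ => ?_
      rw [norm_pow, norm_norm, derivative_expTrunc, map_mul]
      gcongr
      refine (norm_sub_le _ _).trans ?_
      rw [add_mul, ← mul_assoc, norm_mul, norm_mul, norm_mul, Complex.norm_real, Real.norm_eq_abs]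
      gcongr
      · exact norm_aeval_expTrunc_le _ _ _
      · exact norm_aeval_expTrunc_le _ _ _
    · refine Continuous.intervalIntegrable ?_ _ _
      have := hc (derivative W)
      have := hc W
      have := continuous_circleMap 0 1
      fun_prop
    · refine Eventually.of_forall fun θ _ => ?_
      dsimp only
      rw [← mul_pow, ← norm_mul, sub_mul]
      refine (Tendsto.sub ?_ ?_).norm.pow 2
      · simp only [derivative_expTrunc, map_mul, ← mul_assoc]
        exact (hexp _).const_mul _
      · exact ((hexp _).comp (tendsto_add_atTop_nat 1)).const_mul _
  have hl := (((tendsto_aeval_expTrunc W G).comp (tendsto_add_atTop_nat 1)).norm.pow 2)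
  exact le_of_tendsto_of_tendsto' hl (((h0.const_mul σ).add (h1.const_mul σ⁻¹)).const_mul 8)
    fun M => sq_norm_aeval_le hG _ hσ μ

end WienerNorm

/-! ### Uniform bounds for exponentials of quadratic polynomials -/

section QuadraticExponent

open Polynomial Filter Topology

/-- Gaussian comparison through 1 - cos θ ≥ 2θ^2/π^2 on [-π, π]. -/
theorem integral_exp_cos_le {Y : ℝ} (hY : 0 ≤ Y) :
    Real.circleAverage (fun ζ => Real.exp (-(Y * (1 - ζ.re)))) 0 1 ≤ 9 / √(1 + Y) := by
  have hπ := Real.pi_pos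
  -- Using 1 + Y in place of Y keeps the bound finite at Y = 0. The price is a factor exp(2), since
  -- 2θ^2/π^2 ≤ 2 on the interval.
  set c : ℝ := 2 * (1 + Y) / Real.pi ^ 2 with hc
  have hc0 : 0 < c := by positivity
  have hshift : ∫ θ in 0..2 * Real.pi,
      Real.exp (-(Y * (1 - (circleMap 0 1 (θ + -Real.pi)).re))) =
      ∫ θ in -Real.pi..Real.pi, Real.exp (-(Y * (1 - Real.cos θ))) := by
    rw [intervalIntegral.integral_comp_add_right
      (fun θ => Real.exp (-(Y * (1 - (circleMap 0 1 θ).re))))]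
    have e1 : 0 + -Real.pi = -Real.pi := by ring
    have e2 : 2 * Real.pi + -Real.pi = Real.pi := by ring
    rw [e1, e2]
    simp [circleMap, Complex.exp_ofReal_mul_I_re]
  have hgauss : Integrable fun θ : ℝ => Real.exp 2 * Real.exp (-c * θ ^ 2) :=
    (integrable_exp_neg_mul_sq hc0).const_mul _
  have hle : ∫ θ in -Real.pi..Real.pi, Real.exp (-(Y * (1 - Real.cos θ))) ≤
      Real.exp 2 * √(Real.pi / c) := by
    calc ∫ θ in -Real.pi..Real.pi, Real.exp (-(Y * (1 - Real.cos θ)))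
        ≤ ∫ θ in -Real.pi..Real.pi, Real.exp 2 * Real.exp (-c * θ ^ 2) := by
          refine intervalIntegral.integral_mono_on (by linarith)
            (Continuous.intervalIntegrable (by fun_prop) _ _)
            (Continuous.intervalIntegrable (by fun_prop) _ _) fun θ hθ => ?_
          have habs : |θ| ≤ Real.pi := abs_le.2 hθ
          rw [← Real.exp_add]
          refine Real.exp_le_exp.2 ?_
          have h1 := Real.cos_le_one_sub_mul_cos_sq habs
          have h2 : θ ^ 2 ≤ Real.pi ^ 2 := by
            rw [← sq_abs]
            gcongr
          have h3 : 2 / Real.pi ^ 2 * θ ^ 2 ≤ 2 := by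
            rw [div_mul_eq_mul_div, div_le_iff₀ (by positivity)]
            linarith
          have h4 : c * θ ^ 2 = 2 / Real.pi ^ 2 * θ ^ 2 + Y * (2 / Real.pi ^ 2 * θ ^ 2) := by
            rw [hc]
            ring
          have h5 : Y * (2 / Real.pi ^ 2 * θ ^ 2) ≤ Y * (1 - Real.cos θ) := by
            apply mul_le_mul_of_nonneg_left _ hY
            linarith
          linarith
      _ ≤ ∫ θ : ℝ, Real.exp 2 * Real.exp (-c * θ ^ 2) := by
          rw [intervalIntegral.integral_of_le (by linarith)]
          exact setIntegral_le_integral hgauss (Eventually.of_forall fun θ => by positivity)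
      _ = _ := by rw [integral_const_mul, integral_gaussian]
  rw [Real.circleAverage_eq_integral_add (-Real.pi), hshift, smul_eq_mul]
  have hsq : 0 < √(1 + Y) := Real.sqrt_pos.2 (by linarith)
  have hs : √(Real.pi / c) ≤ 2 * Real.pi / √(1 + Y) := by
    rw [Real.sqrt_le_left (by positivity), div_pow, Real.sq_sqrt (by linarith), hc, div_div_eq_mul_div,
      div_le_div_iff₀ (by positivity) (by linarith)]
    have h3 : Real.pi * Real.pi ^ 2 ≤ 8 * Real.pi ^ 2 := by
      gcongr
      linarith [Real.pi_lt_four]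
    nlinarith
  have he : Real.exp 2 ≤ 9 := by
    have h := Real.exp_one_lt_d9.le
    have : Real.exp 2 = Real.exp 1 * Real.exp 1 := by rw [← Real.exp_add]; norm_num
    rw [this]
    nlinarith [Real.exp_pos 1]
  calc (2 * Real.pi)⁻¹ * ∫ θ in -Real.pi..Real.pi, Real.exp (-(Y * (1 - Real.cos θ)))
      ≤ (2 * Real.pi)⁻¹ * (9 * (2 * Real.pi / √(1 + Y))) := by
        gcongr
        refine hle.trans ?_
        gcongr
    _ = 9 / √(1 + Y) := by field_simp

/-- The exponent of a signed compound Poisson element, as a polynomial. -/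
noncomputable def quadExponent (l κ τ : ℝ) : ℝ[X] :=
  C l * ((X - 1) * (C κ - C (τ / 2) * (X - 1)))

/-- With x = Re ζ on the unit circle, the exponent has real part -l(1 - x)(κ - τx), and x ≤ 1 gives
κ - τx ≥ κ - τ. -/
theorem sq_norm_exp_quadExponent_le {l κ τ : ℝ} (hl : 0 ≤ l) (hτ : 0 ≤ τ) {ζ : ℂ}
    (hζ : ‖ζ‖ = 1) :
    ‖Complex.exp (aeval ζ (quadExponent l κ τ))‖ ^ 2 ≤
      Real.exp (-(2 * (l * (κ - τ) * (1 - ζ.re)))) := by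
  have h1 : ζ.re ^ 2 + ζ.im ^ 2 = 1 := by
    have := Complex.sq_norm ζ
    rw [hζ, Complex.normSq_apply] at this
    linarith
  have hre : ζ.re ≤ 1 := by nlinarith [sq_nonneg ζ.im, sq_nonneg (ζ.re - 1)]
  have e : (aeval ζ (quadExponent l κ τ)).re = -(l * ((1 - ζ.re) * (κ - τ * ζ.re))) := by
    simp only [quadExponent, map_mul, map_sub, map_one, aeval_X, aeval_C, Complex.coe_algebraMap,
      Complex.mul_re, Complex.sub_re, Complex.sub_im, Complex.one_re, Complex.one_im,
      Complex.ofReal_re, Complex.ofReal_im, Complex.mul_im]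
    linear_combination (l * τ / 2) * h1
  rw [Complex.norm_exp, ← Real.exp_nat_mul, e]
  refine Real.exp_le_exp.2 ?_
  have h2 : 0 ≤ l * (1 - ζ.re) * (τ * (1 - ζ.re)) := by
    have : 0 ≤ 1 - ζ.re := by linarith
    positivity
  push_cast
  nlinarith

/-- The centre lκ is the derivative of the exponent at 1. The centred quantity therefore has the
factor ζ - 1, which compensates the growth of l near the peak of the exponential. -/
theorem sq_norm_derivative_quadExponent_le {l κ τ : ℝ} (hτ : 0 ≤ τ) (hκ : κ ≤ 1)
    (hb : 0 < κ - τ) {ζ : ℂ} (hζ : ‖ζ‖ = 1) :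
    ‖ζ * aeval ζ (derivative (quadExponent l κ τ)) - ((l * κ : ℝ) : ℂ)‖ ^ 2 ≤
      l ^ 2 * (2 * (1 - ζ.re)) * ((κ - τ) ^ 2 + 2 * (1 - ζ.re)) := by
  have h1 : ζ.re ^ 2 + ζ.im ^ 2 = 1 := by
    have := Complex.sq_norm ζ
    rw [hζ, Complex.normSq_apply] at this
    linarith
  have hre : 0 ≤ 1 - ζ.re := by nlinarith [sq_nonneg ζ.im, sq_nonneg (ζ.re - 1)]
  have e : ζ * aeval ζ (derivative (quadExponent l κ τ)) - ((l * κ : ℝ) : ℂ) =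
      (l : ℂ) * ((ζ - 1) * ((κ : ℂ) - (τ : ℂ) * ζ)) := by
    simp only [quadExponent, derivative_mul, derivative_C, derivative_X,
      derivative_one, map_add, map_mul, map_sub, map_one, aeval_X, aeval_C, map_zero,
      Complex.coe_algebraMap]
    push_cast
    ring
  have e1 : ‖ζ - 1‖ ^ 2 = 2 * (1 - ζ.re) := by
    rw [Complex.sq_norm, Complex.normSq_apply]
    simp only [Complex.sub_re, Complex.sub_im, Complex.one_re, Complex.one_im]
    linear_combination h1
  have e2 : ‖(κ : ℂ) - (τ : ℂ) * ζ‖ ^ 2 = (κ - τ) ^ 2 + 2 * (1 - ζ.re) * (κ * τ) := by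
    rw [Complex.sq_norm, Complex.normSq_apply]
    simp only [Complex.sub_re, Complex.sub_im, Complex.mul_re, Complex.mul_im, Complex.ofReal_re,
      Complex.ofReal_im]
    linear_combination τ ^ 2 * h1
  rw [e, norm_mul, norm_mul, mul_pow, mul_pow, e1, e2, Complex.norm_real, Real.norm_eq_abs, sq_abs,
    mul_assoc (l ^ 2)]
  have hκτ : κ * τ ≤ 1 := by nlinarith
  have : 2 * (1 - ζ.re) * (κ * τ) ≤ 2 * (1 - ζ.re) := by nlinarith
  gcongr

variable {A : Type*} [NormedCommRing A] [NormedAlgebra ℝ A] [NormOneClass A] [CompleteSpace A]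

/-- A signed compound Poisson exponential with a quadratic exponent is bounded, uniformly in its
rate. -/
theorem sq_norm_exp_quadratic_le {G : A} (hG : ‖G‖ ≤ 1) {l κ τ : ℝ} (hl : 0 ≤ l) (hτ : 0 ≤ τ)
    (hκ : κ ≤ 1) (hb : 0 < κ - τ) :
    ‖NormedSpace.exp (l • ((G - 1) * (κ • 1 - (τ / 2) • (G - 1))))‖ ^ 2 ≤ 648 / (κ - τ) := by
  set b := κ - τ with hbdef
  have hb1 : b ≤ 1 := by linarith
  set Y := l * b with hYdef
  have hY : 0 ≤ Y := by positivity
  have hs : 0 < √(1 + Y) := Real.sqrt_pos.2 (by linarith)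
  have hs1 : 1 ≤ √(1 + Y) := Real.one_le_sqrt.2 (by linarith)
  have hss : √(1 + Y) * √(1 + Y) = 1 + Y := Real.mul_self_sqrt (by linarith)
  -- With s = √(1 + Y), the two averages are at most 9/s and 72 s/b^2. The choice σ = s/b turns them
  -- into 9/b and 72/b, both free of l.
  have hσ : 1 ≤ √(1 + Y) / b := by
    rw [le_div_iff₀ hb]
    linarith
  have h := sq_norm_exp_aeval_le hG (quadExponent l κ τ) hσ (l * κ)
  have e : aeval G (quadExponent l κ τ) = l • ((G - 1) * (κ • 1 - (τ / 2) • (G - 1))) := by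
    simp [quadExponent, Algebra.smul_def]
  rw [e] at h
  have hQ : ∀ Q : ℝ[X], Continuous fun ζ : ℂ => aeval ζ Q := fun Q => Q.continuous_aeval
  have hc1 := hQ (quadExponent l κ τ)
  have hc2 := hQ (derivative (quadExponent l κ τ))
  have hnorm : ∀ ζ ∈ Metric.sphere (0 : ℂ) |(1 : ℝ)|, ‖ζ‖ = 1 := fun ζ hζ => by simpa using hζ
  have hre : ∀ ζ : ℂ, ‖ζ‖ = 1 → 0 ≤ 1 - ζ.re := fun ζ hζ => by
    linarith [Complex.re_le_norm ζ]
  have h1 : Real.circleAverage (fun ζ => ‖Complex.exp (aeval ζ (quadExponent l κ τ))‖ ^ 2) 0 1 ≤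
      9 / √(1 + Y) := by
    refine le_trans (Real.circleAverage_mono ?_ ?_ fun ζ hζ => ?_) (integral_exp_cos_le hY)
    · exact Continuous.continuousOn (by fun_prop) |>.circleIntegrable'
    · exact Continuous.continuousOn (by fun_prop) |>.circleIntegrable'
    · refine (sq_norm_exp_quadExponent_le hl hτ (hnorm ζ hζ)).trans (Real.exp_le_exp.2 ?_)
      have := mul_nonneg hY (hre ζ (hnorm ζ hζ))
      linarith
  have h2 : Real.circleAverage (fun ζ =>
      ‖ζ * aeval ζ (derivative (quadExponent l κ τ)) - ((l * κ : ℝ) : ℂ)‖ ^ 2 *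
        ‖Complex.exp (aeval ζ (quadExponent l κ τ))‖ ^ 2) 0 1 ≤
      8 * (1 + Y) / b ^ 2 * (9 / √(1 + Y)) := by
    refine le_trans (Real.circleAverage_mono (f₂ := fun ζ => (8 * (1 + Y) / b ^ 2) •
      Real.exp (-(Y * (1 - ζ.re)))) ?_ ?_ fun ζ hζ => ?_) ?_
    · exact Continuous.continuousOn (by fun_prop) |>.circleIntegrable'
    · exact Continuous.continuousOn (by fun_prop) |>.circleIntegrable'
    · have hζ1 := hnorm ζ hζ
      have hx := hre ζ hζ1
      set w := Y * (1 - ζ.re) with hw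
      have hw0 : 0 ≤ w := by positivity
      -- Half of the decay exp(-2w) absorbs the polynomial in w; the other half is left for the
      -- circle average.
      have hexp1 : w ≤ Real.exp w := by linarith [Real.add_one_le_exp w]
      have hexp2 : w ^ 2 ≤ 2 * Real.exp w := by
        linarith [Real.quadratic_le_exp_of_nonneg hw0]
      calc _ ≤ l ^ 2 * (2 * (1 - ζ.re)) * (b ^ 2 + 2 * (1 - ζ.re)) * Real.exp (-(2 * w)) := by
            refine mul_le_mul (sq_norm_derivative_quadExponent_le hτ hκ hb hζ1) ?_ (by positivity)
              (by positivity)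
            rw [hw, ← mul_assoc]
            refine (sq_norm_exp_quadExponent_le hl hτ hζ1).trans (le_of_eq ?_)
            congr 2
            ring
        _ ≤ (1 / b ^ 2 * (2 * Y * w + 4 * w ^ 2)) * Real.exp (-(2 * w)) := by
            refine mul_le_mul_of_nonneg_right ?_ (Real.exp_pos _).le
            have e1 : 1 / b ^ 2 * (2 * Y * w + 4 * w ^ 2) =
                l ^ 2 * (2 * (1 - ζ.re)) * (1 + 2 * (1 - ζ.re)) := by
              rw [hw, hYdef]
              field_simp
              ring
            rw [e1]
            have : b ^ 2 ≤ 1 := pow_le_one₀ hb.le hb1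
            gcongr
        _ ≤ (1 / b ^ 2 * (8 * (1 + Y) * Real.exp w)) * Real.exp (-(2 * w)) := by
            gcongr
            nlinarith [mul_le_mul_of_nonneg_left hexp1 hY, mul_nonneg hY (Real.exp_pos w).le]
        _ = 8 * (1 + Y) / b ^ 2 * Real.exp (-w) := by
            have : Real.exp w * Real.exp (-(2 * w)) = Real.exp (-w) := by
              rw [← Real.exp_add]; congr 1; ring
            rw [mul_assoc, mul_assoc, this]
            ring
        _ ≤ _ := by
            rw [smul_eq_mul]
    · have := Real.circleAverage_fun_smul (f := fun ζ : ℂ => Real.exp (-(Y * (1 - ζ.re))))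
        (a := 8 * (1 + Y) / b ^ 2) (c := 0) (R := 1)
      rw [this, smul_eq_mul]
      gcongr
      exact integral_exp_cos_le hY
  calc _ ≤ _ := h
    _ ≤ 8 * (√(1 + Y) / b * (9 / √(1 + Y)) +
        (√(1 + Y) / b)⁻¹ * (8 * (1 + Y) / b ^ 2 * (9 / √(1 + Y)))) := by gcongr
    _ = 648 / b := by
        generalize √(1 + Y) = s at hs hss
        rw [← hss]
        field_simp
        norm_num

end QuadraticExponent

/-! ### Taylor remainders and norm estimates for the approximations -/

section Remainder

open NormedSpace

variable {A : Type*} [NormedCommRing A] [NormedAlgebra ℝ A] [NormOneClass A] [CompleteSpace A]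

/-- Third-order Taylor expansion of the exponential with a factored remainder. -/
theorem exists_exp_eq_add_cube_mul (w : A) :
    ∃ R : A, exp w = 1 + w + (1 / 2 : ℝ) • w ^ 2 + w ^ 3 * R ∧ ‖R‖ ≤ Real.exp ‖w‖ := by
  have hbound : ∀ j : ℕ, ‖((j + 3).factorial : ℝ)⁻¹ • w ^ j‖ ≤ ‖w‖ ^ j / (j.factorial : ℝ) := by
    intro j
    rw [norm_smul, norm_inv, Real.norm_natCast, div_eq_inv_mul]
    gcongr
    · omega
    · exact norm_pow_le w j
  have hsum : Summable fun j : ℕ => ((j + 3).factorial : ℝ)⁻¹ • w ^ j :=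
    (hasSum_real_exp ‖w‖).summable.of_norm_bounded hbound
  refine ⟨∑' j : ℕ, ((j + 3).factorial : ℝ)⁻¹ • w ^ j, ?_,
    tsum_of_norm_bounded (hasSum_real_exp ‖w‖) hbound⟩
  have h := exp_series_hasSum_exp' (𝕂 := ℝ) w
  have h3 := (hasSum_nat_add_iff' 3).2 h
  have h4 : HasSum (fun j : ℕ => ((j + 3).factorial : ℝ)⁻¹ • w ^ (j + 3))
      (w ^ 3 * ∑' j : ℕ, ((j + 3).factorial : ℝ)⁻¹ • w ^ j) :=
    hasSum_of_eq (hsum.hasSum.mul_left (w ^ 3))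
      (fun j => by rw [mul_smul_comm, ← pow_add, add_comm 3 j]) rfl
  have e := h3.unique h4
  rw [← e]
  simp [Finset.sum_range_succ, Nat.factorial]

/-- The second-order signed compound Poisson element agrees with `1 + z` to third order. -/
theorem exists_one_add_sub_exp_eq {z : A} (hz : ‖z‖ ≤ 2) :
    ∃ R : A, 1 + z - exp (z - (1 / 2 : ℝ) • z ^ 2) = z ^ 3 * R ∧ ‖R‖ ≤ 1 + 8 * Real.exp 4 := by
  obtain ⟨R, hR, hRn⟩ := exists_exp_eq_add_cube_mul (z - (1 / 2 : ℝ) • z ^ 2)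
  have hhalf : ‖(1 / 2 : ℝ) • z‖ ≤ 1 := by
    rw [norm_smul, Real.norm_of_nonneg (by norm_num)]
    linarith
  have hw : ‖z - (1 / 2 : ℝ) • z ^ 2‖ ≤ 4 := by
    have e : z - (1 / 2 : ℝ) • z ^ 2 = z * (1 - (1 / 2 : ℝ) • z) := by
      simp only [Algebra.smul_def]
      ring
    rw [e]
    refine (norm_mul_le _ _).trans ?_
    have := norm_sub_le (1 : A) ((1 / 2 : ℝ) • z)
    rw [norm_one] at this
    nlinarith [norm_nonneg z, norm_nonneg (1 - (1 / 2 : ℝ) • z)]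
  -- For w = z - z^2/2 = z(1 - z/2) one has w + w^2/2 = z - z^3/2 + z^4/8, and w^3 contributes z^3
  -- (1 - z/2)^3.
  refine ⟨(1 / 2 : ℝ) • 1 - (1 / 8 : ℝ) • z - (1 - (1 / 2 : ℝ) • z) ^ 3 * R, ?_, ?_⟩
  · rw [hR]
    have h2 : (algebraMap ℝ A (1 / 2)) * 2 = 1 := by
      rw [← map_ofNat (algebraMap ℝ A) 2, ← map_mul]
      norm_num
    have h8 : algebraMap ℝ A (1 / 8) = algebraMap ℝ A (1 / 2) ^ 3 := by
      rw [← map_pow]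
      norm_num
    simp only [Algebra.smul_def]
    rw [h8]
    generalize algebraMap ℝ A (1 / 2) = c at h2
    linear_combination (c * z ^ 3) * h2
  · have h1 : ‖(1 / 2 : ℝ) • (1 : A)‖ = 1 / 2 := by
      rw [norm_smul, norm_one, Real.norm_of_nonneg (by norm_num), mul_one]
    have h2 : ‖(1 / 8 : ℝ) • z‖ ≤ 1 / 4 := by
      rw [norm_smul, Real.norm_of_nonneg (by norm_num)]
      linarith
    have h3 : ‖(1 - (1 / 2 : ℝ) • z) ^ 3 * R‖ ≤ 2 ^ 3 * Real.exp 4 := by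
      refine (norm_mul_le _ _).trans ?_
      gcongr
      · refine (norm_pow_le _ _).trans ?_
        gcongr
        refine (norm_sub_le _ _).trans ?_
        rw [norm_one]
        linarith
      · exact hRn.trans (Real.exp_le_exp.2 hw)
    have h4 := norm_sub_le ((1 / 2 : ℝ) • (1 : A) - (1 / 8 : ℝ) • z)
      ((1 - (1 / 2 : ℝ) • z) ^ 3 * R)
    have h5 := norm_sub_le ((1 / 2 : ℝ) • (1 : A)) ((1 / 8 : ℝ) • z)
    linarith

/-- The second-order remainder of an exponential perturbation, in terms of the interpolating
exponentials. -/
theorem norm_exp_sub_sub_le {x y : A} {K : ℝ}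
    (h : ∀ t ∈ Set.Icc (0 : ℝ) 1, ‖y ^ 2 * exp (x - t • y)‖ ≤ K) :
    ‖exp (x - y) - exp x * (1 - y)‖ ≤ K := by
  have hK : 0 ≤ K := (norm_nonneg _).trans (h 0 (by simp))
  have hexp : ∀ t : ℝ, exp x * exp (t • -y) = exp (x - t • y) := fun t => by
    rw [← banach_exp_add, smul_neg, sub_eq_add_neg]
  have hd : ∀ t : ℝ, HasDerivAt (fun s : ℝ => exp (s • -y)) (exp (t • -y) * -y) t := fun t =>
    hasDerivAt_exp_smul_const (-y) t
  -- The remainder along t has second derivative y^2 exp(x - ty), and it vanishes with its first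
  -- derivative at t = 0. The mean value inequality is used once for each order.
  have h1 : ∀ t : ℝ, HasDerivAt (fun s : ℝ => exp x * (y * (1 - exp (s • -y))))
      (y ^ 2 * exp (x - t • y)) t := fun t => by
    convert (((hd t).const_sub 1).const_mul y).const_mul (exp x) using 1
    rw [← hexp]
    ring
  have h2 : ∀ t ∈ Set.Icc (0 : ℝ) 1, ‖exp x * (y * (1 - exp (t • -y)))‖ ≤ K := fun t ht => by
    have := norm_image_sub_le_of_norm_deriv_le_segment' (fun s _ => (h1 s).hasDerivWithinAt)
      (fun s hs => h s (Set.Ico_subset_Icc_self hs)) t ht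
    simp only [zero_smul, exp_zero, sub_self, mul_zero, sub_zero] at this
    exact this.trans (mul_le_of_le_one_right hK ht.2)
  have h3 : ∀ t : ℝ, HasDerivAt (fun s : ℝ => exp x * (exp (s • -y) - 1 + s • y))
      (exp x * (y * (1 - exp (t • -y)))) t := fun t => by
    have := ((((hd t).sub_const 1).add ((hasDerivAt_id t).smul_const y))).const_mul (exp x)
    refine HasDerivAt.congr_deriv this ?_
    rw [one_smul]
    ring
  have h4 := norm_image_sub_le_of_norm_deriv_le_segment_01'
    (fun s _ => (h3 s).hasDerivWithinAt) (fun s hs => h2 s (Set.Ico_subset_Icc_self hs))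
  have e : exp (x - y) - exp x * (1 - y) =
      exp x * (exp ((1 : ℝ) • -y) - 1 + (1 : ℝ) • y) -
        exp x * (exp ((0 : ℝ) • -y) - 1 + (0 : ℝ) • y) := by
    have := hexp 1
    rw [one_smul, one_smul] at this
    rw [← this]
    simp only [zero_smul, exp_zero, one_smul]
    ring
  rw [e]
  exact h4

namespace SymmetricWalk

variable {ι : Type*} [Fintype ι] (W : SymmetricWalk A ι)

/-- After z = r(G - 1) with r = 1 - q, the parameters are κ = 1 - q/2 and τ = tr ≤ 1 - q, so κ - τ ≥
q/2. Then 648/(q/2) = 36^2/q. -/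
theorem norm_exp_twisted_le (hq : W.q < 1) {a t : ℝ} (ha : 0 ≤ a) (ht : t ∈ Set.Icc (0 : ℝ) 1) :
    ‖exp (a • ((1 - W.q / 2) • W.gen - (t / 2) • W.gen ^ 2))‖ ≤ 36 / √W.q := by
  have hq0 := W.q_pos
  set r := 1 - W.q with hr
  have hr0 : 0 < r := by linarith
  set G : A := r⁻¹ • ∑ i, W.p i • symmAvg (W.u i) (W.v i) with hG
  have hG1 : ‖G‖ ≤ 1 := by
    rw [hG, norm_smul, norm_inv, Real.norm_of_nonneg hr0.le, inv_mul_le_one₀ hr0]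
    exact W.norm_sum_le
  have hz : W.gen = r • (G - 1) := by
    have h : W.gen = (W.q • 1 + ∑ i, W.p i • symmAvg (W.u i) (W.v i)) - 1 := by
      rw [← W.one_add_gen]
      ring
    rw [h, hG, smul_sub, smul_smul, mul_inv_cancel₀ hr0.ne', one_smul, hr]
    module
  have hb : W.q / 2 ≤ (1 - W.q / 2) - t * r := by
    have : t * r ≤ 1 * r := by gcongr; exact ht.2
    linarith
  have h := sq_norm_exp_quadratic_le hG1 (l := a * r) (κ := 1 - W.q / 2) (τ := t * r)
    (mul_nonneg ha hr0.le) (mul_nonneg ht.1 hr0.le) (by linarith) (by linarith)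
  have e : (a * r) • ((G - 1) * ((1 - W.q / 2) • 1 - (t * r / 2) • (G - 1))) =
      a • ((1 - W.q / 2) • W.gen - (t / 2) • W.gen ^ 2) := by
    clear_value r
    rw [hz, smul_pow, mul_sub, mul_smul_comm, mul_smul_comm, mul_one, ← sq]
    module
  rw [e] at h
  rw [le_div_iff₀ (Real.sqrt_pos.2 hq0)]
  refine abs_le_of_sq_le_sq' ?_ (by norm_num) |>.2
  rw [mul_pow, Real.sq_sqrt hq0.le]
  have h2 : (648 : ℝ) / ((1 - W.q / 2) - t * r) ≤ 648 / (W.q / 2) := by gcongr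
  calc _ ≤ 648 / (W.q / 2) * W.q := by
        gcongr
        exact h.trans h2
    _ = _ := by
        field_simp
        norm_num

/-- The time a is shared equally among the k factors of the generator. -/
theorem norm_gen_pow_mul_exp_le {a : ℝ} (ha : 0 < a) {k : ℕ} (hk : k ≠ 0) :
    ‖W.gen ^ k * exp (a • W.gen)‖ ≤ (k * Fintype.card ι / a) ^ k := by
  have hk0 : (0 : ℝ) < k := by positivity
  have e : a • W.gen = k • ((a / k) • W.gen) := by
    rw [← Nat.cast_smul_eq_nsmul ℝ, smul_smul, mul_div_cancel₀ _ hk0.ne']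
  rw [e, banach_exp_nsmul, ← mul_pow]
  refine (norm_pow_le _ _).trans ?_
  gcongr
  refine (W.norm_gen_mul_exp_le (div_pos ha hk0)).trans (le_of_eq ?_)
  field_simp

/-- A share q/2 of the Poisson time is set aside to smooth powers of the generator; the remaining
signed factor still has a bound uniform in a. -/
theorem exp_signed_eq (a t : ℝ) :
    exp (a • W.gen - t • ((a / 2) • W.gen ^ 2)) = exp ((W.q / 2 * a) • W.gen) *
      exp (a • ((1 - W.q / 2) • W.gen - (t / 2) • W.gen ^ 2)) := by
  rw [← banach_exp_add]
  congr 1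
  module

theorem norm_exp_signed_le (hq : W.q < 1) {a t : ℝ} (ha : 0 ≤ a) (ht : t ∈ Set.Icc (0 : ℝ) 1) :
    ‖exp (a • W.gen - t • ((a / 2) • W.gen ^ 2))‖ ≤ 36 / √W.q := by
  have hq0 := W.q_pos
  rw [exp_signed_eq]
  refine (norm_mul_le _ _).trans ?_
  refine (mul_le_of_le_one_left (norm_nonneg _) (W.norm_exp_smul_gen_le (by positivity))).trans ?_
  exact W.norm_exp_twisted_le hq ha ht

theorem norm_gen_pow_mul_exp_signed_le (hq : W.q < 1) {a t : ℝ} (ha : 0 < a)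
    (ht : t ∈ Set.Icc (0 : ℝ) 1) {k : ℕ} (hk : k ≠ 0) :
    ‖W.gen ^ k * exp (a • W.gen - t • ((a / 2) • W.gen ^ 2))‖ ≤
      (2 * k * Fintype.card ι / (W.q * a)) ^ k * (36 / √W.q) := by
  have hq0 := W.q_pos
  rw [exp_signed_eq, ← mul_assoc]
  refine (norm_mul_le _ _).trans ?_
  gcongr
  · refine (W.norm_gen_pow_mul_exp_le (by positivity) hk).trans (le_of_eq ?_)
    congr 1
    field_simp
  · exact W.norm_exp_twisted_le hq ha.le ht

theorem norm_pow_le_one (n : ℕ) : ‖(1 + W.gen) ^ n‖ ≤ 1 :=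
  (norm_pow_le _ _).trans (pow_le_one₀ (norm_nonneg _) W.norm_one_add_gen_le)

theorem norm_gen_cube_mul_pow_le (n : ℕ) :
    ‖W.gen ^ 3 * (1 + W.gen) ^ n‖ ≤ (6 * Fintype.card ι / (W.q * (n + 1))) ^ 3 := by
  have hq := W.q_pos
  have e : W.gen ^ 3 * (1 + W.gen) ^ n =
      (W.gen * (1 + W.gen) ^ (n / 3)) ^ 3 * (1 + W.gen) ^ (n % 3) := by
    nth_rewrite 1 [← Nat.div_add_mod n 3]
    rw [pow_add, pow_mul, mul_pow, ← pow_mul, ← pow_mul, mul_comm 3 (n / 3)]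
    ring
  have h4 : (n : ℝ) + 1 ≤ 3 * ((n / 3 : ℕ) + 1) := by
    have : n + 1 ≤ 3 * (n / 3 + 1) := by omega
    exact_mod_cast this
  rw [e]
  refine (norm_mul_le _ _).trans ((mul_le_of_le_one_right (norm_nonneg _)
    (W.norm_pow_le_one _)).trans ((norm_pow_le _ _).trans ?_))
  gcongr
  refine (W.norm_gen_mul_pow_le _).trans ?_
  have e2 : (2 : ℝ) * Fintype.card ι / (W.q * ((n / 3 : ℕ) + 1)) =
      6 * Fintype.card ι / (W.q * (3 * ((n / 3 : ℕ) + 1))) := by field_simp; ring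
  rw [e2]
  gcongr

theorem exp_signed_nsmul (k : ℕ) :
    exp (W.gen - (1 / 2 : ℝ) • W.gen ^ 2) ^ k =
      exp ((k : ℝ) • W.gen - (1 : ℝ) • ((k / 2 : ℝ) • W.gen ^ 2)) := by
  rw [← banach_exp_nsmul, ← Nat.cast_smul_eq_nsmul ℝ]
  congr 1
  module

/-- One of j + 1 and k is at least n/2. The corresponding factor does all the smoothing, and the
other is merely bounded. -/
theorem norm_gen_cube_mul_mixed_le (hq : W.q < 1) {n j k : ℕ} (hn : j + 1 + k = n) :
    ‖W.gen ^ 3 * ((1 + W.gen) ^ j * exp (W.gen - (1 / 2 : ℝ) • W.gen ^ 2) ^ k)‖ ≤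
      (12 * Fintype.card ι / (W.q * n)) ^ 3 * (36 / √W.q) := by
  have hq0 := W.q_pos
  have hn0 : (0 : ℝ) < n := by
    have : 0 < n := by omega
    exact_mod_cast this
  have hn' : (j : ℝ) + 1 + k = n := by exact_mod_cast hn
  rw [exp_signed_nsmul]
  have h1 : (1 : ℝ) ∈ Set.Icc (0 : ℝ) 1 := by simp
  have e12 : (12 : ℝ) * Fintype.card ι / (W.q * n) = 6 * Fintype.card ι / (W.q * (n / 2)) := by
    field_simp
    ring
  rw [e12]
  rcases le_total ((n : ℝ) / 2) (j + 1) with h | h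
  · rw [← mul_assoc]
    refine (norm_mul_le _ _).trans ?_
    gcongr
    · refine (W.norm_gen_cube_mul_pow_le j).trans ?_
      gcongr
    · exact W.norm_exp_signed_le hq (by positivity) h1
  · have hk : (n : ℝ) / 2 ≤ k := by linarith
    have hk0 : (0 : ℝ) < k := by linarith
    rw [mul_left_comm]
    refine (norm_mul_le _ _).trans ((mul_le_of_le_one_left (norm_nonneg _)
      (W.norm_pow_le_one _)).trans ?_)
    refine (W.norm_gen_pow_mul_exp_signed_le hq hk0 h1 three_ne_zero).trans ?_
    gcongr
    norm_num

/-- The second-order signed compound Poisson approximation of the powers of a symmetric walk. -/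
theorem norm_pow_sub_signed_le (hq : W.q < 1) {n : ℕ} (hn : n ≠ 0) :
    ‖(1 + W.gen) ^ n - exp ((n : ℝ) • W.gen - (n / 2 : ℝ) • W.gen ^ 2)‖ ≤
      62208 * (1 + 8 * Real.exp 4) * Fintype.card ι ^ 3 / (W.q ^ 3 * √W.q * n ^ 2) := by
  have hq0 := W.q_pos
  have hsq := Real.sqrt_pos.2 hq0
  have hn0 : (0 : ℝ) < n := by positivity
  obtain ⟨R, hR, hRn⟩ := exists_one_add_sub_exp_eq W.norm_gen_le
  have e : exp ((n : ℝ) • W.gen - (n / 2 : ℝ) • W.gen ^ 2) =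
      exp (W.gen - (1 / 2 : ℝ) • W.gen ^ 2) ^ n := by
    rw [exp_signed_nsmul, one_smul]
  -- The difference of nth powers is a sum of n mixed products times z^3 R. Each summand costs
  -- (12N/(qn))^3 · 36/√q, and 62208 = 12^3 · 36.
  rw [e, ← geom_sum₂_mul, hR, ← mul_assoc, mul_comm _ (W.gen ^ 3), Finset.mul_sum]
  refine (norm_mul_le _ _).trans ?_
  calc _ ≤ (∑ _j ∈ Finset.range n, (12 * Fintype.card ι / (W.q * n)) ^ 3 * (36 / √W.q)) *
        (1 + 8 * Real.exp 4) := by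
        gcongr
        refine norm_sum_le_of_le _ fun j hj => ?_
        have hj' := Finset.mem_range.1 hj
        exact W.norm_gen_cube_mul_mixed_le hq (by omega)
    _ = _ := by
        rw [Finset.sum_const, Finset.card_range, nsmul_eq_mul]
        field_simp
        ring

/-- Second-order Taylor remainder in y = (a/2) z^2: y^2 carries a^2/4, while smoothing z^4 gains
a^(-4). -/
theorem norm_signed_sub_expansion_le (hq : W.q < 1) {a : ℝ} (ha : 0 < a) :
    ‖exp (a • W.gen - (a / 2) • W.gen ^ 2) - exp (a • W.gen) * (1 - (a / 2) • W.gen ^ 2)‖ ≤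
      36864 * Fintype.card ι ^ 4 / (W.q ^ 4 * √W.q * a ^ 2) := by
  have hq0 := W.q_pos
  have hsq := Real.sqrt_pos.2 hq0
  refine norm_exp_sub_sub_le fun t ht => ?_
  have h := W.norm_gen_pow_mul_exp_signed_le hq ha ht four_ne_zero
  rw [smul_pow, ← pow_mul, smul_mul_assoc, norm_smul, Real.norm_of_nonneg (by positivity)]
  calc _ ≤ (a / 2) ^ 2 * ((2 * (4 : ℕ) * Fintype.card ι / (W.q * a)) ^ 4 * (36 / √W.q)) := by
        gcongr
    _ = _ := by
        push_cast
        field_simp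
        ring

theorem norm_pow_sub_expansion_le (hq : W.q < 1) {n : ℕ} (hn : n ≠ 0) :
    ‖(1 + W.gen) ^ n - exp ((n : ℝ) • W.gen) * (1 - (n / 2 : ℝ) • W.gen ^ 2)‖ ≤
      62208 * (1 + 8 * Real.exp 4) * Fintype.card ι ^ 3 / (W.q ^ 3 * √W.q * n ^ 2) +
        36864 * Fintype.card ι ^ 4 / (W.q ^ 4 * √W.q * n ^ 2) :=
  (norm_sub_le_norm_sub_add_norm_sub _ _ _).trans (add_le_add (W.norm_pow_sub_signed_le hq hn)
    (W.norm_signed_sub_expansion_le hq (by positivity)))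

/-- The main term is -(n/2) z^2 exp(nz). Only pure Poisson smoothing enters it, so its constant 2
does not involve q. -/
theorem norm_pow_sub_accompanying_le (hq : W.q < 1) {n : ℕ} (hn : n ≠ 0) :
    ‖(1 + W.gen) ^ n - exp ((n : ℝ) • W.gen)‖ ≤
      2 * Fintype.card ι ^ 2 / n +
      (62208 * (1 + 8 * Real.exp 4) * Fintype.card ι ^ 3 / (W.q ^ 3 * √W.q * n ^ 2) +
        36864 * Fintype.card ι ^ 4 / (W.q ^ 4 * √W.q * n ^ 2)) := by
  have hn0 : (0 : ℝ) < n := by positivity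
  have e : (1 + W.gen) ^ n - exp ((n : ℝ) • W.gen) =
      -((n / 2 : ℝ) • (W.gen ^ 2 * exp ((n : ℝ) • W.gen))) +
        ((1 + W.gen) ^ n - exp ((n : ℝ) • W.gen) * (1 - (n / 2 : ℝ) • W.gen ^ 2)) := by
    rw [mul_sub, mul_smul_comm, mul_comm (exp ((n : ℝ) • W.gen)) (W.gen ^ 2)]
    ring
  rw [e]
  refine (norm_add_le _ _).trans (add_le_add ?_ (W.norm_pow_sub_expansion_le hq hn))
  rw [norm_neg, norm_smul, Real.norm_of_nonneg (by positivity)]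
  calc _ ≤ (n / 2 : ℝ) * ((2 : ℕ) * Fintype.card ι / n) ^ 2 := by
        gcongr
        exact W.norm_gen_pow_mul_exp_le hn0 two_ne_zero
    _ = _ := by
        push_cast
        field_simp

end SymmetricWalk

end Remainder

/-! ### The Banach algebra of summable discrete signed measures -/

section WienerAlgebra

open UniformSpace UniformSpace.Completion

variable {V : Type*} [AddCommMonoid V]

/-- The total variation seminorm on finitely supported measures. -/
noncomputable def variationSeminorm (V : Type*) [AddCommMonoid V] :
    RingSeminorm (AddMonoidAlgebra ℝ V) where
  toFun x := x.coeff.sum fun _ r => |r|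
  map_zero' := by simp
  add_le' x y := by
    classical
    rw [AddMonoidAlgebra.coeff_add, Finsupp.sum_of_support_subset _ Finsupp.support_add _ (by simp),
      Finsupp.sum_of_support_subset x.coeff Finset.subset_union_left _ (by simp),
      Finsupp.sum_of_support_subset y.coeff Finset.subset_union_right _ (by simp),
      ← Finset.sum_add_distrib]
    exact Finset.sum_le_sum fun i _ => abs_add_le _ _
  neg' x := by
    simp [Finsupp.sum]
  mul_le' x y := by
    classical
    have hadd : ∀ (ι : Type _) (s : Finset ι) (f : ι → AddMonoidAlgebra ℝ V),
        ((∑ i ∈ s, f i).coeff.sum fun _ r => |r|) ≤ ∑ i ∈ s, (f i).coeff.sum fun _ r => |r| := by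
      intro ι s f
      induction s using Finset.induction_on with
      | empty => simp
      | insert a s ha ih =>
        rw [Finset.sum_insert ha, Finset.sum_insert ha]
        refine le_trans ?_ (add_le_add_right ih _)
        rw [AddMonoidAlgebra.coeff_add,
          Finsupp.sum_of_support_subset _ Finsupp.support_add _ (by simp),
          Finsupp.sum_of_support_subset (f a).coeff Finset.subset_union_left _ (by simp),
          Finsupp.sum_of_support_subset (∑ i ∈ s, f i).coeff Finset.subset_union_right _ (by simp),
          ← Finset.sum_add_distrib]
        exact Finset.sum_le_sum fun i _ => abs_add_le _ _
    rw [AddMonoidAlgebra.mul_def, Finsupp.sum]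
    refine (hadd _ _ _).trans ?_
    rw [Finsupp.sum, Finset.sum_mul]
    refine Finset.sum_le_sum fun i _ => ?_
    rw [Finsupp.sum]
    refine (hadd _ _ _).trans ?_
    rw [Finsupp.sum, Finset.mul_sum]
    refine Finset.sum_le_sum fun j _ => ?_
    rw [AddMonoidAlgebra.coeff_single, Finsupp.sum_single_index (by simp), abs_mul]

noncomputable instance : SeminormedCommRing (AddMonoidAlgebra ℝ V) where
  __ := (variationSeminorm V).toSeminormedRing
  mul_comm := mul_comm

theorem norm_eq_sum_coeff (x : AddMonoidAlgebra ℝ V) : ‖x‖ = x.coeff.sum fun _ r => |r| := rfl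

noncomputable instance : NormedAlgebra ℝ (AddMonoidAlgebra ℝ V) where
  norm_smul_le r x := by
    rw [norm_eq_sum_coeff, norm_eq_sum_coeff, AddMonoidAlgebra.coeff_smul,
      Finsupp.sum_of_support_subset _ Finsupp.support_smul _ (by simp), Finsupp.sum, Finset.mul_sum]
    refine Finset.sum_le_sum fun i _ => ?_
    rw [Finsupp.smul_apply, smul_eq_mul, abs_mul, Real.norm_eq_abs]

theorem norm_single (m : V) (r : ℝ) : ‖AddMonoidAlgebra.single m r‖ = |r| := by
  rw [norm_eq_sum_coeff, AddMonoidAlgebra.coeff_single, Finsupp.sum_single_index (by simp)]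

/-- The Banach algebra of summable discrete signed measures. -/
abbrev WienerAlgebra (V : Type*) [AddCommMonoid V] : Type _ := Completion (AddMonoidAlgebra ℝ V)

instance : NormOneClass (WienerAlgebra V) where
  norm_one := by rw [← coe_one, norm_coe, AddMonoidAlgebra.one_def, norm_single, abs_one]

/-- The mass given to a set by a finitely supported measure. -/
noncomputable def finMass (B : Set V) : AddMonoidAlgebra ℝ V →L[ℝ] ℝ :=
  LinearMap.mkContinuous
    { toFun := fun x => Finsupp.linearCombination ℝ (B.indicator (1 : V → ℝ)) x.coeff
      map_add' := fun x y => by rw [AddMonoidAlgebra.coeff_add, map_add]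
      map_smul' := fun r x => by rw [AddMonoidAlgebra.coeff_smul, map_smul, RingHom.id_apply] } 1
    fun x => by
      rw [one_mul, norm_eq_sum_coeff]
      refine norm_sum_le_of_le _ fun m _ => ?_
      by_cases hm : m ∈ B <;> simp [hm]

theorem finMass_single (B : Set V) (m : V) (r : ℝ) :
    finMass B (AddMonoidAlgebra.single m r) = r * B.indicator 1 m := by
  simp [finMass]

theorem finMass_eq_sum (B : Set V) (x : AddMonoidAlgebra ℝ V) :
    finMass B x = x.coeff.sum fun m r => r * B.indicator 1 m := by
  simp [finMass, Finsupp.linearCombination_apply]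

theorem norm_finMass_le (B : Set V) (x : AddMonoidAlgebra ℝ V) : ‖finMass B x‖ ≤ ‖x‖ := by
  refine (ContinuousLinearMap.le_of_opNorm_le _ (LinearMap.mkContinuous_norm_le _ zero_le_one _)
    x).trans ?_
  rw [one_mul]

/-- The mass given to a set by a summable discrete signed measure. -/
noncomputable def mass (B : Set V) : WienerAlgebra V →L[ℝ] ℝ :=
  (finMass B).extend (toComplL (𝕜 := ℝ))

theorem mass_coe (B : Set V) (x : AddMonoidAlgebra ℝ V) : mass B (x : WienerAlgebra V) =
    finMass B x :=
  ContinuousLinearMap.extend_eq _ denseRange_coe (isUniformInducing_coe _) x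

theorem abs_mass_le (B : Set V) (a : WienerAlgebra V) : |mass B a| ≤ ‖a‖ := by
  induction a using induction_on with
  | hp => exact isClosed_le (by fun_prop) (by fun_prop)
  | ih x =>
    rw [mass_coe, norm_coe]
    exact norm_finMass_le B x

/-- The unit mass at a point, as an element of the Banach algebra. -/
noncomputable def delta (v : V) : WienerAlgebra V :=
  ((AddMonoidAlgebra.single v 1 : AddMonoidAlgebra ℝ V) : WienerAlgebra V)

theorem norm_delta (v : V) : ‖delta v‖ = 1 := by
  rw [delta, norm_coe, norm_single, abs_one]

theorem delta_mul (v w : V) : delta v * delta w = delta (v + w) := by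
  rw [delta, delta, ← coe_mul, AddMonoidAlgebra.single_mul_single, mul_one, delta]

theorem delta_zero : delta (0 : V) = 1 := by
  rw [delta, ← AddMonoidAlgebra.one_def, coe_one]

theorem coe_single (v : V) (r : ℝ) :
    ((AddMonoidAlgebra.single v r : AddMonoidAlgebra ℝ V) : WienerAlgebra V) = r • delta v := by
  rw [delta, ← Completion.coe_smul, AddMonoidAlgebra.smul_single, smul_eq_mul, mul_one]

theorem mass_preimage_add (B : Set V) (v : V) (a : WienerAlgebra V) :
    mass ((fun y => y + v) ⁻¹' B) a = mass B (a * delta v) := by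
  induction a using induction_on with
  | hp => exact isClosed_eq (by fun_prop) (by fun_prop)
  | ih x =>
    rw [delta, ← coe_mul, mass_coe, mass_coe]
    induction x using AddMonoidAlgebra.induction_linear with
    | zero => simp
    | add x y hx hy => rw [map_add, add_mul, map_add, hx, hy]
    | single m r =>
      rw [AddMonoidAlgebra.single_mul_single, finMass_single, finMass_single, mul_one]
      rfl

theorem coe_eq_sum (x : AddMonoidAlgebra ℝ V) :
    (x : WienerAlgebra V) = ∑ m ∈ x.coeff.support, x.coeff m • delta m := by
  conv_lhs => rw [← AddMonoidAlgebra.sum_coeff_single x, Finsupp.sum]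
  rw [← coe_toComplL (𝕜 := ℝ), map_sum]
  exact Finset.sum_congr rfl fun m _ => coe_single m _

end WienerAlgebra

/-! ### Signed measures represented in the Banach algebra -/

section Representation

open UniformSpace UniformSpace.Completion

variable {V : Type*} [AddCommMonoid V] [MeasurableSpace V]

theorem signedMeasure_sum_apply {ι : Type*} (s : Finset ι) (M : ι → SignedMeasure V) (B : Set V) :
    (∑ i ∈ s, M i) B = ∑ i ∈ s, M i B := by
  classical
  induction s using Finset.induction_on with
  | empty => simp
  | insert i s hi ih => rw [Finset.sum_insert hi, Finset.sum_insert hi, add_apply, ih]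

/-- A signed measure is represented by an element of the Banach algebra of discrete measures. -/
def Represents (M : SignedMeasure V) (a : WienerAlgebra V) : Prop :=
  ∀ B, MeasurableSet B → M B = mass B a

/-- The mass of a fixed set is a linear functional of norm at most one, uniformly in the set. -/
theorem Represents.tvDist_le {M N : SignedMeasure V} {a b : WienerAlgebra V}
    (hM : Represents M a) (hN : Represents N b) : tvDist M N ≤ ‖a - b‖ := by
  refine Real.iSup_le (fun B => ?_) (norm_nonneg _)
  rw [hM _ B.2, hN _ B.2, ← map_sub]
  exact abs_mass_le _ _

theorem represents_unitMass : Represents (unitMass : SignedMeasure V) 1 := by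
  intro B hB
  rw [← coe_one, mass_coe, AddMonoidAlgebra.one_def, finMass_single, unitMass, one_mul]
  by_cases h : (0 : V) ∈ B
  · rw [VectorMeasure.dirac_apply_of_mem hB h, Set.indicator_of_mem h, Pi.one_apply]
  · rw [VectorMeasure.dirac_apply_of_notMem h, Set.indicator_of_notMem h]

theorem Represents.sub {M N : SignedMeasure V} {a b : WienerAlgebra V}
    (hM : Represents M a) (hN : Represents N b) : Represents (M - N) (a - b) := fun B hB => by
  rw [sub_apply, hM B hB, hN B hB, map_sub]

theorem Represents.smul {M : SignedMeasure V} {a : WienerAlgebra V} (hM : Represents M a) (r : ℝ) :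
    Represents (r • M) (r • a) := fun B hB => by
  rw [smul_apply, hM B hB, map_smul]

/-- Convolution with a finitely supported measure. -/
theorem Represents.conv [MeasurableAdd₂ V] {M N : SignedMeasure V} {a : WienerAlgebra V}
    {x : AddMonoidAlgebra ℝ V} (hM : Represents M a) (hN : Represents N x) :
    Represents (conv M N) (a * x) := by
  have hpair : ∀ v : V, Measurable fun y : V => (y, v) := fun v => by fun_prop
  -- With finitely many atoms on the right, the product measure is a finite combination of copies of
  -- the left factor, and convolution becomes a sum of translates.
  have hprod : VectorMeasure.prod M N (ContinuousLinearMap.mul ℝ ℝ) =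
      ∑ v ∈ x.coeff.support, x.coeff v • M.map fun y => (y, v) := by
    refine VectorMeasure.prod_eq_of_forall_apply_prod fun s t hs ht => ?_
    rw [hN t ht, mass_coe, finMass_eq_sum, Finsupp.sum, ContinuousLinearMap.mul_apply',
      Finset.mul_sum, signedMeasure_sum_apply]
    refine Finset.sum_congr rfl fun v _ => ?_
    rw [smul_apply, VectorMeasure.map_apply _ (hpair v) (hs.prod ht), smul_eq_mul]
    by_cases hv : v ∈ t
    · have : (fun y : V => (y, v)) ⁻¹' s ×ˢ t = s := by ext y; simp [hv]
      rw [this, Set.indicator_of_mem hv, Pi.one_apply]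
      ring
    · have : (fun y : V => (y, v)) ⁻¹' s ×ˢ t = ∅ := by ext y; simp [hv]
      rw [this, Set.indicator_of_notMem hv, VectorMeasure.empty]
      ring
  intro B hB
  rw [CompoundPoisson.conv, VectorMeasure.map_apply _ measurable_add hB, hprod,
    signedMeasure_sum_apply, coe_eq_sum, Finset.mul_sum, map_sum]
  refine Finset.sum_congr rfl fun v _ => ?_
  rw [smul_apply, VectorMeasure.map_apply _ (hpair v) (measurable_add hB),
    mul_smul_comm, map_smul, ← mass_preimage_add, ← hM _ ((measurable_add_const v) hB)]
  rfl

theorem Represents.convPow [MeasurableAdd₂ V] {N : SignedMeasure V} {x : AddMonoidAlgebra ℝ V}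
    (hN : Represents N x) (j : ℕ) : Represents (convPow N j) ((x : WienerAlgebra V) ^ j) := by
  induction j with
  | zero => exact represents_unitMass
  | succ j ih =>
    rw [pow_succ]
    exact ih.conv hN

/-- The mass functional is continuous, so it passes through the exponential series term by term. -/
theorem Represents.expMeasure [MeasurableAdd₂ V] {N : SignedMeasure V} {x : AddMonoidAlgebra ℝ V}
    (hN : Represents N x) :
    Represents (expMeasure N) (NormedSpace.exp (x : WienerAlgebra V)) := by
  intro B hB
  have h := (NormedSpace.exp_series_hasSum_exp' (𝕂 := ℝ) (x : WienerAlgebra V)).mapL (mass B)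
  rw [← h.tsum_eq]
  refine tsum_congr fun j => ?_
  rw [hN.convPow j B hB, map_smul, smul_eq_mul, inv_mul_eq_div]

end Representation

/-! ### Symmetric finitely supported laws as lazy walks -/

section SymmetricMeasure

variable {V : Type*} [AddCommGroup V]

theorem symmAvg_comm {A : Type*} [NormedCommRing A] [NormedAlgebra ℝ A] (u v : A) :
    symmAvg u v = symmAvg v u := by
  rw [symmAvg, symmAvg, add_comm]

theorem sum_smul_delta_eq_sum_symmAvg {S : Finset V} {w : V → ℝ} (hneg : ∀ s ∈ S, -s ∈ S)
    (hw : ∀ s, w (-s) = w s) :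
    ∑ s ∈ S, w s • delta s = ∑ s ∈ S, w s • symmAvg (delta s) (delta (-s)) := by
  have h : ∑ s ∈ S, w s • delta (-s) = ∑ s ∈ S, w s • delta s :=
    Finset.sum_nbij' (fun s => -s) (fun s => -s) hneg hneg (fun s _ => neg_neg s)
      (fun s _ => neg_neg s) fun s _ => by rw [hw]
  have e : ∀ s, w s • symmAvg (delta s) (delta (-s)) =
      (1 / 2 : ℝ) • (w s • delta s + w s • delta (-s)) := fun s => by
    rw [symmAvg]
    module
  simp only [e]
  rw [← Finset.smul_sum, Finset.sum_add_distrib, h]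
  module

/-- A symmetric finitely supported distribution with an atom at the origin is the one-step
distribution of a lazy symmetric walk. -/
theorem exists_symmetricWalk {ι : Type*} [Fintype ι] [Nonempty ι] {S : Finset V} {x : ι → V}
    {w : V → ℝ} (hS : ∀ s, s ∈ S ↔ s = 0 ∨ ∃ i, s = x i ∨ s = -x i) (hw0 : ∀ s, 0 ≤ w s)
    (hw : ∀ s, w (-s) = w s) (hq : 0 < w 0) (hsum : ∑ s ∈ S, w s = 1) :
    ∃ W : SymmetricWalk (WienerAlgebra V) ι,
      W.q = w 0 ∧ 1 + W.gen = ∑ s ∈ S, w s • delta s := by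
  classical
  -- The points x_i may vanish or coincide up to sign. Assigning each nonzero atom to a single index
  -- counts its mass once; an index that receives no atom gets weight zero.
  have hchoose : ∀ s, ∃ i, s ∈ S.erase 0 → s = x i ∨ s = -x i := fun s => by
    by_cases hs : s ∈ S.erase 0
    · obtain ⟨h0, hs⟩ := Finset.mem_erase.1 hs
      obtain ⟨i, hi⟩ := ((hS s).1 hs).resolve_left h0
      exact ⟨i, fun _ => hi⟩
    · exact ⟨Classical.arbitrary ι, fun h => absurd h hs⟩
  choose j hj using hchoose
  have h0S : (0 : V) ∈ S := (hS 0).2 (Or.inl rfl)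
  let W : SymmetricWalk (WienerAlgebra V) ι :=
    { u := fun i => delta (x i)
      v := fun i => delta (-x i)
      p := fun i => ∑ s ∈ S.erase 0 with j s = i, w s
      q := w 0
      mul_eq_one := fun i => by rw [delta_mul, add_neg_cancel, delta_zero]
      norm_u_le := fun i => (norm_delta _).le
      norm_v_le := fun i => (norm_delta _).le
      p_nonneg := fun i => Finset.sum_nonneg fun s _ => hw0 s
      q_pos := hq
      add_sum_eq_one := by
        rw [Finset.sum_fiberwise (S.erase 0) j w, Finset.add_sum_erase _ _ h0S, hsum] }
  refine ⟨W, rfl, ?_⟩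
  rw [W.one_add_gen, sum_smul_delta_eq_sum_symmAvg (fun s hs => ?_) hw,
    ← Finset.add_sum_erase _ _ h0S]
  · congr 1
    · change w 0 • (1 : WienerAlgebra V) = _
      rw [neg_zero, delta_zero, symmAvg]
      module
    · rw [← Finset.sum_fiberwise (S.erase 0) j]
      refine Finset.sum_congr rfl fun i _ => ?_
      change (∑ s ∈ S.erase 0 with j s = i, w s) • symmAvg (delta (x i)) (delta (-x i)) = _
      rw [Finset.sum_smul]
      refine Finset.sum_congr rfl fun s hs => ?_
      obtain ⟨hs, hsi⟩ := Finset.mem_filter.1 hs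
      have h := hj s hs
      rw [hsi] at h
      rcases h with rfl | rfl
      · rfl
      · rw [neg_neg, symmAvg_comm]
  · rw [hS] at hs ⊢
    rcases hs with rfl | ⟨i, rfl | rfl⟩
    · exact Or.inl neg_zero
    · exact Or.inr ⟨i, Or.inr rfl⟩
    · exact Or.inr ⟨i, Or.inl (neg_neg _)⟩

theorem represents_of_finite_support [MeasurableSpace V] [MeasurableSingletonClass V]
    {F : Measure V} [IsFiniteMeasure F] {S : Finset V} (hS : F (S : Set V)ᶜ = 0) :
    Represents F.toSignedMeasure
      ((∑ s ∈ S, AddMonoidAlgebra.single s (F.real {s}) : AddMonoidAlgebra ℝ V) :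
        WienerAlgebra V) := by
  classical
  intro B hB
  rw [Measure.toSignedMeasure_apply_measurable hB, mass_coe, map_sum]
  have h1 : F.real B = F.real (B ∩ S) := by
    rw [measureReal_def, measureReal_def, measure_inter_conull hS]
  have h2 : B ∩ S = ((S.filter (· ∈ B) : Finset V) : Set V) := by
    ext y
    simp [and_comm]
  rw [h1, h2, ← sum_measureReal_singleton, Finset.sum_filter]
  refine Finset.sum_congr rfl fun s _ => ?_
  rw [finMass_single]
  by_cases hs : s ∈ B <;> simp [hs]

end SymmetricMeasure

/-! ### Algebra elements of the comparison measures -/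

section Transfer

open NormedSpace UniformSpace.Completion

variable {V : Type*} [AddCommGroup V] [MeasurableSpace V] [MeasurableAdd₂ V]
  {F : SignedMeasure V} {f : AddMonoidAlgebra ℝ V}

theorem Represents.sub_unitMass (hF : Represents F f) :
    Represents (F - unitMass) ((f - 1 : AddMonoidAlgebra ℝ V) : WienerAlgebra V) := by
  rw [UniformSpace.Completion.coe_sub, coe_one]
  exact hF.sub represents_unitMass

theorem coe_sub_one_sq :
    (((f - 1) ^ 2 : AddMonoidAlgebra ℝ V) : WienerAlgebra V) = ((f : WienerAlgebra V) - 1) ^ 2 := by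
  rw [sq, coe_mul, UniformSpace.Completion.coe_sub, coe_one, sq]

theorem Represents.accompanying (hF : Represents F f) (a : ℝ) :
    Represents (accompanying F a) (exp (a • ((f : WienerAlgebra V) - 1))) := by
  have h : Represents (a • (F - unitMass))
      ((a • (f - 1) : AddMonoidAlgebra ℝ V) : WienerAlgebra V) := by
    rw [UniformSpace.Completion.coe_smul]
    exact hF.sub_unitMass.smul a
  have e := h.expMeasure
  rwa [UniformSpace.Completion.coe_smul, UniformSpace.Completion.coe_sub, coe_one] at e

theorem Represents.hipp (hF : Represents F f) (a : ℝ) :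
    Represents (hipp F a) (exp (a • ((f : WienerAlgebra V) - 1) -
      (a / 2) • ((f : WienerAlgebra V) - 1) ^ 2)) := by
  have h : Represents (a • (F - unitMass) - (a / 2) • CompoundPoisson.convPow (F - unitMass) 2)
      ((a • (f - 1) - (a / 2) • (f - 1) ^ 2 : AddMonoidAlgebra ℝ V) : WienerAlgebra V) := by
    rw [UniformSpace.Completion.coe_sub, UniformSpace.Completion.coe_smul,
      UniformSpace.Completion.coe_smul, sq, coe_mul, ← sq]
    exact (hF.sub_unitMass.smul a).sub ((hF.sub_unitMass.convPow 2).smul (a / 2))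
  have e := h.expMeasure
  rwa [UniformSpace.Completion.coe_sub, UniformSpace.Completion.coe_smul,
    UniformSpace.Completion.coe_smul, coe_sub_one_sq, UniformSpace.Completion.coe_sub,
    coe_one] at e

theorem Represents.cpExpansion (hF : Represents F f) (a : ℝ) :
    Represents (cpExpansion F a) (exp (a • ((f : WienerAlgebra V) - 1)) *
      (1 - (a / 2) • ((f : WienerAlgebra V) - 1) ^ 2)) := by
  have h : Represents (unitMass - (a / 2) • CompoundPoisson.convPow (F - unitMass) 2)
      ((1 - (a / 2) • (f - 1) ^ 2 : AddMonoidAlgebra ℝ V) : WienerAlgebra V) := by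
    rw [UniformSpace.Completion.coe_sub, UniformSpace.Completion.coe_smul, sq, coe_mul, ← sq,
      coe_one]
    exact represents_unitMass.sub ((hF.sub_unitMass.convPow 2).smul (a / 2))
  have e := (hF.accompanying a).conv h
  rwa [UniformSpace.Completion.coe_sub, UniformSpace.Completion.coe_smul, coe_sub_one_sq,
    coe_one] at e

end Transfer

/-! ### Constants and powers of q -/

section Constants

theorem rpow_neg_half_eq {q : ℝ} (hq : 0 < q) (m : ℕ) :
    q ^ (-(((2 * m + 1 : ℕ) : ℝ) / 2)) = (q ^ m * √q)⁻¹ := by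
  rw [Real.rpow_neg hq.le, Real.sqrt_eq_rpow, ← Real.rpow_natCast, ← Real.rpow_add hq]
  congr 2
  push_cast
  ring

/-- If N ≤ √n, the spare factor N/√n and q ≤ √q reduce both remainders to the stated form. If N ≥
√n, the trivial bound 2 is already below 2.17 N^2/n. -/
theorem accompanying_bound_le {N n : ℕ} {q K L δ : ℝ} (hn : 1 ≤ n) (hN : 1 ≤ N) (hq : 0 < q)
    (hq1 : q < 1) (hK : 0 ≤ K) (hL : 0 ≤ L) (hδ2 : δ ≤ 2)
    (hδ : δ ≤ 2 * (N : ℝ) ^ 2 / n + (K * N ^ 3 / (q ^ 3 * √q * n ^ 2) +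
      L * N ^ 4 / (q ^ 4 * √q * n ^ 2))) :
    δ ≤ 2.17 * (N : ℝ) ^ 2 / n * (1 + (K + L) * N / (q ^ 5 * √n)) := by
  have hn0 : (0 : ℝ) < n := by exact_mod_cast hn
  have hN0 : (1 : ℝ) ≤ N := by exact_mod_cast hN
  have hsn : 0 < √(n : ℝ) := Real.sqrt_pos.2 hn0
  have hsn1 : 1 ≤ √(n : ℝ) := Real.one_le_sqrt.2 (by exact_mod_cast hn)
  have hsn2 : √(n : ℝ) ^ 2 = n := Real.sq_sqrt hn0.le
  rcases le_total (N : ℝ) (√n) with h | h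
  · have hqs : q ≤ √q := Real.le_sqrt_of_sq_le (by nlinarith)
    have h1 : K * N ^ 3 / (q ^ 3 * √q * n ^ 2) ≤ K * N ^ 3 / (q ^ 5 * (√n * n)) := by
      have : q ^ 5 * (√n * n) ≤ q ^ 3 * √q * (n : ℝ) ^ 2 := by
        calc q ^ 5 * (√n * n) ≤ q ^ 4 * (n * n) := by
              gcongr ?_ * (?_ * _)
              · exact pow_le_pow_of_le_one hq.le hq1.le (by norm_num)
              · nlinarith
          _ = q ^ 3 * q * (n : ℝ) ^ 2 := by ring
          _ ≤ _ := by gcongr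
      gcongr
    have h2 : L * N ^ 4 / (q ^ 4 * √q * n ^ 2) ≤ L * N ^ 3 / (q ^ 5 * (√n * n)) := by
      rw [div_le_div_iff₀ (by positivity) (by positivity)]
      have : (N : ℝ) * (q ^ 5 * (√n * n)) ≤ q ^ 4 * √q * (n : ℝ) ^ 2 := by
        calc (N : ℝ) * (q ^ 5 * (√n * n)) ≤ √n * (q ^ 5 * (√n * n)) := by gcongr
          _ = q ^ 4 * q * (√(n : ℝ) ^ 2 * n) := by ring
          _ = q ^ 4 * q * (n : ℝ) ^ 2 := by rw [hsn2]; ring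
          _ ≤ _ := by gcongr
      calc L * (N : ℝ) ^ 4 * (q ^ 5 * (√n * n)) = L * N ^ 3 * (N * (q ^ 5 * (√n * n))) := by ring
        _ ≤ L * N ^ 3 * (q ^ 4 * √q * (n : ℝ) ^ 2) := by gcongr
    calc δ ≤ 2 * (N : ℝ) ^ 2 / n + (K * N ^ 3 / (q ^ 5 * (√n * n)) +
          L * N ^ 3 / (q ^ 5 * (√n * n))) := hδ.trans (by gcongr)
      _ = 2 * (N : ℝ) ^ 2 / n + 1 * (N : ℝ) ^ 2 / n * ((K + L) * N / (q ^ 5 * √n)) := by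
          field_simp
      _ ≤ 2.17 * (N : ℝ) ^ 2 / n + 2.17 * (N : ℝ) ^ 2 / n * ((K + L) * N / (q ^ 5 * √n)) := by
          gcongr <;> norm_num
      _ = _ := by ring
  · have h1 : 1 ≤ (N : ℝ) ^ 2 / n := by
      rw [one_le_div hn0, ← hsn2]
      gcongr
    have h2 : 0 ≤ (K + L) * N / (q ^ 5 * √n) := by positivity
    calc δ ≤ 2.17 * 1 * (1 + 0) := by linarith
      _ ≤ 2.17 * ((N : ℝ) ^ 2 / n) * (1 + (K + L) * N / (q ^ 5 * √n)) := by gcongr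
      _ = _ := by ring

end Constants

end CompoundPoisson

/-! ### The four approximation bounds -/

theorem corollary1 :
    ∃ C : ℝ, 0 < C ∧
      ∀ (d N n : ℕ) (F : Measure (Fin d → ℝ)) [IsProbabilityMeasure F]
        (x : Fin N → Fin d → ℝ) (q : ℝ),
        1 ≤ n →
        d ≤ N →
        F.map (fun y => -y) = F →
        F.support ⊆ Set.range (fun (m : Fin d → ℤ) (i : Fin d) => (m i : ℝ)) →
        F.support = {0} ∪ (Set.range x ∪ Set.range (fun i => -x i)) →
        q = F.real {0} →
        0 < q →
        q < 1 →
        CompoundPoisson.tvDist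
            (CompoundPoisson.convPow F.toSignedMeasure n)
            (CompoundPoisson.accompanying F.toSignedMeasure n)
          ≤ 2.17 * (N : ℝ) ^ 2 / n * (1 + C * N / (q ^ 5 * Real.sqrt n)) ∧
        CompoundPoisson.tvDist
            (CompoundPoisson.convPow F.toSignedMeasure n)
            (CompoundPoisson.convPow F.toSignedMeasure (n + 1))
          ≤ C * (N : ℝ) ^ 2 * q ^ (-(7 / 2) : ℝ) / n ∧
        CompoundPoisson.tvDist
            (CompoundPoisson.convPow F.toSignedMeasure n)
            (CompoundPoisson.hipp F.toSignedMeasure n)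
          ≤ C * (N : ℝ) ^ 3 * q ^ (-(7 / 2) : ℝ) / (n : ℝ) ^ 2 ∧
        CompoundPoisson.tvDist
            (CompoundPoisson.convPow F.toSignedMeasure n)
            (CompoundPoisson.cpExpansion F.toSignedMeasure n)
          ≤ C * (N : ℝ) ^ 4 * q ^ (-(13 / 2) : ℝ) / (n : ℝ) ^ 2 := by
  set K : ℝ := 62208 * (1 + 8 * Real.exp 4) with hKdef
  have hK : 0 < K := by positivity
  -- K is the constant of the signed approximation and 36864 that of its expansion; the other two
  -- bounds need no more than their sum.
  refine ⟨K + 36864, by positivity, ?_⟩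
  intro d N n F _ x q hn _ hsymm _ hsupp hq hq0 hq1
  have hfin : F.support.Finite := by
    rw [hsupp]
    exact (Set.finite_singleton _).union ((Set.finite_range _).union (Set.finite_range _))
  set S := hfin.toFinset with hSdef
  have hScoe : (S : Set (Fin d → ℝ)) = F.support := hfin.coe_toFinset
  have hnull : F (S : Set (Fin d → ℝ))ᶜ = 0 := by
    rw [hScoe]
    exact Measure.measure_compl_support
  have hSmem : ∀ s, s ∈ S ↔ s = 0 ∨ ∃ i, s = x i ∨ s = -x i := fun s => by
    rw [hSdef, Set.Finite.mem_toFinset, hsupp]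
    simp only [Set.mem_union, Set.mem_singleton_iff, Set.mem_range, exists_or, eq_comm]
  have hsum : ∑ s ∈ S, F.real {s} = 1 := by
    rw [sum_measureReal_singleton]
    have := measureReal_add_measureReal_compl (μ := F) S.measurableSet
    rw [measureReal_def F (S : Set (Fin d → ℝ))ᶜ, hnull] at this
    simpa using this
  have hsymm' : ∀ s, F.real {-s} = F.real {s} := fun s => by
    conv_rhs => rw [← hsymm]
    rw [map_measureReal_apply measurable_neg (measurableSet_singleton s)]
    congr 1
    ext y
    simp
  -- With N = 0 all mass would sit at the origin, contradicting q < 1.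
  have hN : 1 ≤ N := by
    by_contra h0
    have hN0 : N = 0 := by omega
    subst hN0
    have : S = {0} := by
      ext s
      rw [hSmem]
      simp
    rw [this, Finset.sum_singleton, ← hq] at hsum
    linarith
  have : Nonempty (Fin N) := ⟨⟨0, hN⟩⟩
  obtain ⟨W, hWq, hW⟩ := CompoundPoisson.exists_symmetricWalk (S := S) (x := x)
    (w := fun s => F.real {s}) hSmem (fun _ => measureReal_nonneg) hsymm' (hq ▸ hq0) hsum
  have hrep := CompoundPoisson.represents_of_finite_support (F := F) hnull
  set f : AddMonoidAlgebra ℝ (Fin d → ℝ) := ∑ s ∈ S, AddMonoidAlgebra.single s (F.real {s})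
    with hf
  have hWf : (f : CompoundPoisson.WienerAlgebra (Fin d → ℝ)) = 1 + W.gen := by
    rw [hW, hf, ← UniformSpace.Completion.coe_toComplL (𝕜 := ℝ), map_sum]
    exact Finset.sum_congr rfl fun s _ => CompoundPoisson.coe_single _ _
  have hgen : (f : CompoundPoisson.WienerAlgebra (Fin d → ℝ)) - 1 = W.gen := by rw [hWf]; ring
  have hWq' : W.q = q := by rw [hWq, hq]
  have hq1' : W.q < 1 := by rw [hWq']; exact hq1
  have hn' : n ≠ 0 := by omega
  have hn0 : (0 : ℝ) < n := by exact_mod_cast hn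
  have hN0 : (1 : ℝ) ≤ N := by exact_mod_cast hN
  have hsq := Real.sqrt_pos.2 hq0
  have hsq1 : √q ≤ 1 := Real.sqrt_le_one.2 hq1.le
  have e7 : q ^ (-(7 / 2) : ℝ) = (q ^ 3 * √q)⁻¹ := by
    rw [← CompoundPoisson.rpow_neg_half_eq hq0]
    norm_num
  have e13 : q ^ (-(13 / 2) : ℝ) = (q ^ 6 * √q)⁻¹ := by
    rw [← CompoundPoisson.rpow_neg_half_eq hq0]
    norm_num
  have hpow := hrep.convPow n
  rw [hWf] at hpow
  rw [e7, e13]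
  refine ⟨?_, ?_, ?_, ?_⟩
  · have hacc := hrep.accompanying n
    rw [hgen] at hacc
    refine (hpow.tvDist_le hacc).trans ?_
    refine CompoundPoisson.accompanying_bound_le hn hN hq0 hq1 hK.le (by norm_num) ?_ ?_
    · refine (norm_sub_le _ _).trans ?_
      linarith [W.norm_pow_le_one n, W.norm_exp_smul_gen_le hn0.le]
    · have := W.norm_pow_sub_accompanying_le hq1' hn'
      rwa [Fintype.card_fin, hWq'] at this
  · have hsucc := hrep.convPow (n + 1)
    rw [hWf] at hsucc
    refine (hpow.tvDist_le hsucc).trans ?_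
    have e : (1 + W.gen) ^ n - (1 + W.gen) ^ (n + 1) = -(W.gen * (1 + W.gen) ^ n) := by ring
    rw [e, norm_neg]
    have h := W.norm_gen_mul_pow_le n
    rw [Fintype.card_fin, hWq'] at h
    have h1 : q ^ 3 * √q ≤ q := by
      calc q ^ 3 * √q ≤ q ^ 1 * 1 := by
            gcongr ?_ * ?_
            exact pow_le_pow_of_le_one hq0.le hq1.le (by norm_num)
        _ = q := by ring
    calc _ ≤ 2 * (N : ℝ) / (q * (n + 1)) := h
      _ ≤ (K + 36864) * (N : ℝ) ^ 2 / (q ^ 3 * √q * n) := by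
          gcongr
          · linarith
          · nlinarith
          · linarith
      _ = _ := by field_simp
  · have hh := hrep.hipp n
    rw [hgen] at hh
    refine (hpow.tvDist_le hh).trans ?_
    have h := W.norm_pow_sub_signed_le hq1' hn'
    rw [Fintype.card_fin, hWq', ← hKdef] at h
    calc _ ≤ K * (N : ℝ) ^ 3 / (q ^ 3 * √q * n ^ 2) := h
      _ ≤ (K + 36864) * (N : ℝ) ^ 3 / (q ^ 3 * √q * n ^ 2) := by
          gcongr
          linarith
      _ = _ := by field_simp
  · have hh := hrep.cpExpansion n
    rw [hgen] at hh
    refine (hpow.tvDist_le hh).trans ?_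
    have h := W.norm_pow_sub_expansion_le hq1' hn'
    rw [Fintype.card_fin, hWq', ← hKdef] at h
    calc _ ≤ K * (N : ℝ) ^ 3 / (q ^ 3 * √q * n ^ 2) +
          36864 * (N : ℝ) ^ 4 / (q ^ 4 * √q * n ^ 2) := h
      _ ≤ K * (N : ℝ) ^ 4 / (q ^ 6 * √q * n ^ 2) +
          36864 * (N : ℝ) ^ 4 / (q ^ 6 * √q * n ^ 2) := by
          have h3 : q ^ 6 ≤ q ^ 3 := pow_le_pow_of_le_one hq0.le hq1.le (by norm_num)
          have h4 : q ^ 6 ≤ q ^ 4 := pow_le_pow_of_le_one hq0.le hq1.le (by norm_num)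
          have hN34 : (N : ℝ) ^ 3 ≤ (N : ℝ) ^ 4 := pow_le_pow_right₀ hN0 (by norm_num)
          gcongr
      _ = _ := by field_simp
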